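/- **Theorem (Fundamental Identity of Gabor Analysis, Janssen representation, Wexler–Raz relations).** Write $\langle f,g\rangle=\int_{\mathbb R^d} f(t)\overline{g(t)}\,dt$ for the inner product of $L^2(\mathbb R^d)$, and for $z=(x,\omega)\in\mathbb R^{2d}$ let $\pi(z)f(t)=e^{2\pi i\omega\cdot t}f(t-x)$ be the time-frequency shift. Let $M^1(\mathbb R^d)=\{f\in L^2(\mathbb R^d): \mathcal V_f f\in L^1(\mathbb R^{2d})\}$, where $\mathcal V_g f(z)=\langle f,\pi(z)g\rangle$, be Feichtinger's algebra. Let $\Lambda\subset\mathbb R^{2d}$ be a (full-rank) lattice, $\mathrm{vol}(\Lambda)$ its covolume, $\Lambda^*=\{w\in\mathbb R^{2d}: w\cdot\lambda\in\mathbb Z \text{ for all }\lambda\in\Lambda\}$ its dual lattice, and $\Lambda^\circ=J\Lambda^*$ its adjoint lattice, where $J(x,\omega)=(\omega,-x)$. Let $g_1,\dots,g_M,h_1,\dots,h_M\in M^1(\mathbb R^d)$, and let $$S_{g,h}^{\Lambda}f=\sum_{i=1}^M\sum_{\lambda\in\Lambda}\langle f,\pi(\lambda)g_i\rangle\,\pi(\lambda)h_i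 ,\qquad f\in L^2(\mathbb R^d),$$ be the mixed frame operator. Then the following hold. 1. (Fundamental Identity of Gabor Analysis) For all $f_1,f_2\in L^2(\mathbb R^d)$, $$\sum_{i=1}^M\sum_{\lambda\in\Lambda}\langle f_1,\pi(\lambda)g_i\rangle\langle\pi(\lambda)h_i,f_2\rangle=\mathrm{vol}(\Lambda)^{-1}\sum_{i=1}^M\sum_{\lambda^\circ\in\Lambda^\circ}\langle h_i,\pi(\lambda^\circ)g_i\rangle\langle\pi(\lambda^\circ)f_1,f_2\rangle ,$$ where both series converge absolutely. 2. (Janssen representation) For every $f\in L^2(\mathbb R^d)$ the series defining $S_{g,h}^\Lambda f$ converges unconditionally in $L^2(\mathbb R^d)$, and $$S_{g,h}^{\Lambda}=\mathrm{vol}(\Lambda)^{-1}\sum_{i=1}^M\sum_{\lambda^\circ\in\Lambda^\circ}\langle h_i,\pi(\lambda^\circ)g_i\rangle\,\pi(\lambda^\circ),$$ where the series converges unconditionally in the strong operator sense on $L^2(\mathbb R^d)$. 3. (Wexler–Raz biorthogonality relations) $S_{g,h}^{\Lambda}=I$ on $L^2(\mathbb R^d)$ if and only if $$\mathrm{vol}(\Lambda)^{-1}\sum_{i=1}^M\langle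 h_i,\pi(\lambda^\circ)g_i\rangle=\delta_{\lambda^\circ,0}\qquad\text{for all }\lambda^\circ\in\Lambda^\circ .$$ -/

import Mathlib

open MeasureTheory

noncomputable section

/-- The configuration space `ℝ^d`, with its Euclidean structure and Lebesgue measure. -/
abbrev ConfigSpace (d : ℕ) : Type := EuclideanSpace ℝ (Fin d)

/-- The time-frequency plane `ℝ^{2d}`; its points are written `z = (x, ω)`. -/
abbrev PhaseSpace (d : ℕ) : Type := ConfigSpace d × ConfigSpace d

/-- The Hilbert space `L²(ℝ^d)` of complex-valued square integrable functions. -/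
abbrev L2 (d : ℕ) : Type := Lp ℂ 2 (volume : Measure (ConfigSpace d))

/-- The inner product `⟨f, g⟩ = ∫ f(t) conj(g(t)) dt` of `L²(ℝ^d)`, linear in the *first*
argument (Mathlib's `inner` is linear in the second one). -/
def pairing {d : ℕ} (f g : L2 d) : ℂ := inner ℂ g f

/-- The pointwise formula `(π(x, ω) f)(t) = e^{2 π i ω · t} f(t - x)`. -/
def tfShiftFun {d : ℕ} (z : PhaseSpace d) (f : ConfigSpace d → ℂ) : ConfigSpace d → ℂ :=
  fun t => Complex.exp (2 * Real.pi * Complex.I * ((inner ℝ z.2 t : ℝ) : ℂ)) * f (t - z.1)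

theorem memLp_tfShiftFun {d : ℕ} (z : PhaseSpace d) {f : ConfigSpace d → ℂ}
    (hf : MemLp f 2 volume) : MemLp (tfShiftFun z f) 2 volume := by
  have h1 : MemLp (fun t => f (t - z.1)) 2 volume :=
    hf.comp_measurePreserving (measurePreserving_sub_right volume z.1)
  have hc : Continuous fun t : ConfigSpace d =>
      Complex.exp (2 * Real.pi * Complex.I * ((inner ℝ z.2 t : ℝ) : ℂ)) := by fun_prop
  refine h1.of_le (hc.aestronglyMeasurable.mul h1.aestronglyMeasurable) ?_
  refine Filter.Eventually.of_forall fun t => ?_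
  have he : ‖Complex.exp (2 * Real.pi * Complex.I * ((inner ℝ z.2 t : ℝ) : ℂ))‖ = 1 := by
    rw [Complex.norm_exp]; simp
  simp only [tfShiftFun, norm_mul, he, one_mul, le_refl]

/-- The time-frequency shift operator `π(z)` on `L²(ℝ^d)`. -/
def tfShift {d : ℕ} (z : PhaseSpace d) (f : L2 d) : L2 d :=
  (memLp_tfShiftFun z (Lp.memLp f)).toLp (tfShiftFun z f)

/-- The short-time Fourier transform
`V_g f (x, ω) = ∫ f(t) conj(g(t - x)) e^{-2 π i ω · t} dt = ⟨f, π(x, ω) g⟩`. -/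
def stft {d : ℕ} (g f : L2 d) (z : PhaseSpace d) : ℂ := pairing f (tfShift z g)

/-- Feichtinger's algebra `M¹(ℝ^d) = {f ∈ L²(ℝ^d) : V_f f ∈ L¹(ℝ^{2d})}`. -/
def feichtingerAlgebra (d : ℕ) : Set (L2 d) :=
  {f | Integrable (stft f f) (volume : Measure (PhaseSpace d))}

/-- The Euclidean dot product of `ℝ^{2d}`. -/
def phaseDot {d : ℕ} (w z : PhaseSpace d) : ℝ := inner ℝ w.1 z.1 + inner ℝ w.2 z.2

/-- The dual lattice `Λ* = {w : w · z ∈ ℤ for all z ∈ Λ}`; it is `A^{-T} ℤ^{2d}` when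
`Λ = A ℤ^{2d}`. -/
def dualLattice {d : ℕ} (Λ : Submodule ℤ (PhaseSpace d)) : Submodule ℤ (PhaseSpace d) where
  carrier := {w | ∀ z ∈ Λ, ∃ k : ℤ, phaseDot w z = k}
  zero_mem' := fun z _ => ⟨0, by simp [phaseDot]⟩
  add_mem' := by
    intro a b ha hb z hz
    obtain ⟨k, hk⟩ := ha z hz
    obtain ⟨l, hl⟩ := hb z hz
    refine ⟨k + l, ?_⟩
    rw [Int.cast_add, ← hk, ← hl]
    simp only [phaseDot, Prod.fst_add, Prod.snd_add, inner_add_left]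
    ring
  smul_mem' := by
    intro c a ha z hz
    obtain ⟨k, hk⟩ := ha z hz
    refine ⟨c * k, ?_⟩
    rw [Int.cast_mul, ← hk, ← Int.cast_smul_eq_zsmul ℝ c a]
    simp only [phaseDot, Prod.smul_fst, Prod.smul_snd, real_inner_smul_left]
    ring

/-- The map `J (x, ω) = (ω, -x)`. -/
def symplecticJ (d : ℕ) : PhaseSpace d →ₗ[ℤ] PhaseSpace d :=
  (LinearMap.snd ℤ (ConfigSpace d) (ConfigSpace d)).prod
    (-LinearMap.fst ℤ (ConfigSpace d) (ConfigSpace d))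

/-- The adjoint lattice `Λ° = J Λ*`. -/
def adjointLattice {d : ℕ} (Λ : Submodule ℤ (PhaseSpace d)) : Submodule ℤ (PhaseSpace d) :=
  (dualLattice Λ).map (symplecticJ d)

/-- The mixed frame operator `S_{g,h} f = ∑ᵢ ∑_{z ∈ Λ} ⟨f, π(z) gᵢ⟩ π(z) hᵢ`. -/
def mixedFrameOperator {d M : ℕ} (Λ : Submodule ℤ (PhaseSpace d)) (g h : Fin M → L2 d)
    (f : L2 d) : L2 d :=
  ∑ i, ∑' z : Λ, pairing f (tfShift (z : PhaseSpace d) (g i)) • tfShift (z : PhaseSpace d) (h i)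

end

noncomputable section

open Filter Topology ComplexConjugate FourierTransform
open scoped ENNReal SchwartzMap

variable {d : ℕ}

/-! The theorem is Poisson summation for F(z) = ∑ᵢ V_{gᵢ}f₁(z) · conj(V_{hᵢ}f₂(z)), which is
integrable by Moyal's identity. Its periodization along Λ is P(u) = ∑ᵢ ⟨Sᵢ π(-u)f₁, π(-u)f₂⟩, with
Sᵢ the frame operator of the pair (gᵢ, hᵢ). So P is continuous for arbitrary f₁, f₂ in L², because
each Sᵢ is bounded and π is strongly continuous (`hasSum_periodization`,
`continuous_periodization`).

The characters trivial on Λ are z ↦ e^{2πiσ(w,z)} with w ∈ Λ°. Such a phase is what commuting π(z)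
past π(w) costs, so Moyal's identity also computes the Fourier coefficients of P: vol(Λ)⁻¹ ∑ᵢ ⟨hᵢ,
π(w)gᵢ⟩⟨π(w)f₁, f₂⟩ (`integral_character_mul_stft`). They are absolutely summable, so the Fourier
series at u = 0 is the fundamental identity. Janssen's representation is its operator form. If S = I
then P is constant, and the vanishing of its other coefficients gives Wexler–Raz.

The analytic input is that V_g h is summable over every lattice when g, h lie in M¹
(`summable_norm_stft`). This is propagated from the Gaussian by the convolution inequality
`enorm_stft_mul_le`. Summability of V_g g also yields the Bessel bounds behind each Sᵢ, by Schur's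
test. -/

/-- The character value `e^{2 π i s}`. -/
def expTwoPiI (s : ℝ) : ℂ := Complex.exp (2 * Real.pi * Complex.I * (s : ℂ))

theorem expTwoPiI_zero : expTwoPiI 0 = 1 := by simp [expTwoPiI]

theorem expTwoPiI_add (s t : ℝ) : expTwoPiI (s + t) = expTwoPiI s * expTwoPiI t := by
  rw [expTwoPiI, expTwoPiI, expTwoPiI, ← Complex.exp_add]
  congr 1
  push_cast
  ring

theorem expTwoPiI_neg (s : ℝ) : expTwoPiI (-s) = conj (expTwoPiI s) := by
  rw [expTwoPiI, expTwoPiI, ← Complex.exp_conj]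
  congr 1
  simp [Complex.conj_ofNat]

theorem norm_expTwoPiI (s : ℝ) : ‖expTwoPiI s‖ = 1 := by
  rw [expTwoPiI, Complex.norm_exp]
  simp

theorem conj_expTwoPiI_mul_self (s : ℝ) : conj (expTwoPiI s) * expTwoPiI s = 1 := by
  rw [← expTwoPiI_neg, ← expTwoPiI_add, neg_add_cancel, expTwoPiI_zero]

theorem expTwoPiI_intCast (k : ℤ) : expTwoPiI k = 1 := by
  rw [expTwoPiI, Complex.exp_eq_one_iff]
  exact ⟨k, by push_cast; ring⟩

theorem continuous_expTwoPiI : Continuous expTwoPiI := by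
  unfold expTwoPiI
  fun_prop

/-! ### The pairing -/

theorem pairing_eq_integral (f g : L2 d) : pairing f g = ∫ t, f t * conj (g t) := by
  rw [pairing, L2.inner_def]
  rfl

theorem pairing_add_left (f₁ f₂ g : L2 d) :
    pairing (f₁ + f₂) g = pairing f₁ g + pairing f₂ g := inner_add_right _ _ _

theorem pairing_add_right (f g₁ g₂ : L2 d) :
    pairing f (g₁ + g₂) = pairing f g₁ + pairing f g₂ := inner_add_left _ _ _

theorem pairing_smul_left (c : ℂ) (f g : L2 d) : pairing (c • f) g = c * pairing f g :=
  inner_smul_right _ _ _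

theorem pairing_smul_right (c : ℂ) (f g : L2 d) : pairing f (c • g) = conj c * pairing f g :=
  inner_smul_left _ _ _

theorem conj_pairing (f g : L2 d) : conj (pairing f g) = pairing g f := inner_conj_symm _ _

theorem pairing_sum_left {α : Type*} (s : Finset α) (u : α → L2 d) (g : L2 d) :
    pairing (∑ a ∈ s, u a) g = ∑ a ∈ s, pairing (u a) g := inner_sum _ _ _

theorem norm_pairing_comm (f g : L2 d) : ‖pairing f g‖ = ‖pairing g f‖ := norm_inner_symm _ _

theorem norm_pairing_le (f g : L2 d) : ‖pairing f g‖ ≤ ‖f‖ * ‖g‖ := by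
  rw [mul_comm]
  exact norm_inner_le_norm _ _

theorem pairing_self (f : L2 d) : pairing f f = (‖f‖ : ℂ) ^ 2 := inner_self_eq_norm_sq_to_K _

/-! ### Time-frequency shifts as isometries -/

theorem tfShiftFun_apply (z : PhaseSpace d) (f : ConfigSpace d → ℂ) (t : ConfigSpace d) :
    tfShiftFun z f t = expTwoPiI (inner ℝ z.2 t) * f (t - z.1) := rfl

theorem coeFn_tfShift (z : PhaseSpace d) (f : L2 d) : tfShift z f =ᵐ[volume] tfShiftFun z f :=
  MemLp.coeFn_toLp _

theorem ae_comp_sub_right (x : ConfigSpace d) {p : ConfigSpace d → Prop} (h : ∀ᵐ t, p t) :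
    ∀ᵐ t, p (t - x) :=
  (measurePreserving_sub_right volume x).quasiMeasurePreserving.ae h

theorem tfShift_add (z : PhaseSpace d) (f g : L2 d) :
    tfShift z (f + g) = tfShift z f + tfShift z g := by
  apply Lp.ext
  filter_upwards [coeFn_tfShift z (f + g), coeFn_tfShift z f, coeFn_tfShift z g,
    Lp.coeFn_add (tfShift z f) (tfShift z g), ae_comp_sub_right z.1 (Lp.coeFn_add f g)]
    with t h1 h2 h3 h4 h5
  rw [h1, h4, Pi.add_apply, h2, h3, tfShiftFun_apply, h5, Pi.add_apply, mul_add]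
  rfl

theorem tfShift_smul (z : PhaseSpace d) (c : ℂ) (f : L2 d) :
    tfShift z (c • f) = c • tfShift z f := by
  apply Lp.ext
  filter_upwards [coeFn_tfShift z (c • f), coeFn_tfShift z f,
    Lp.coeFn_smul c (tfShift z f), ae_comp_sub_right z.1 (Lp.coeFn_smul c f)]
    with t h1 h2 h4 h5
  rw [h1, h4, Pi.smul_apply, h2, tfShiftFun_apply, h5, Pi.smul_apply, tfShiftFun_apply,
    smul_eq_mul, smul_eq_mul]
  ring

theorem pairing_tfShift_tfShift (z : PhaseSpace d) (f g : L2 d) :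
    pairing (tfShift z f) (tfShift z g) = pairing f g := by
  rw [pairing_eq_integral, pairing_eq_integral,
    ← integral_sub_right_eq_self (fun t => f t * conj (g t)) z.1]
  refine integral_congr_ae ?_
  filter_upwards [coeFn_tfShift z f, coeFn_tfShift z g] with t h1 h2
  rw [h1, h2, tfShiftFun_apply, tfShiftFun_apply, map_mul]
  linear_combination (f (t - z.1) * conj (g (t - z.1))) *
    conj_expTwoPiI_mul_self (inner ℝ z.2 t)

theorem norm_tfShift (z : PhaseSpace d) (f : L2 d) : ‖tfShift z f‖ = ‖f‖ := by
  have h := pairing_tfShift_tfShift z f f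
  rw [pairing_self, pairing_self] at h
  have h2 : ‖tfShift z f‖ ^ 2 = ‖f‖ ^ 2 := by exact_mod_cast h
  exact (sq_eq_sq₀ (norm_nonneg _) (norm_nonneg _)).mp h2

/-- The time-frequency shift `π(z)` as a linear isometry. -/
def tfShiftLI (z : PhaseSpace d) : L2 d →ₗᵢ[ℂ] L2 d where
  toFun := tfShift z
  map_add' := tfShift_add z
  map_smul' := tfShift_smul z
  norm_map' := norm_tfShift z

theorem tfShift_sub (z : PhaseSpace d) (f g : L2 d) :
    tfShift z (f - g) = tfShift z f - tfShift z g := map_sub (tfShiftLI z) f g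

theorem tfShift_tfShift (w z : PhaseSpace d) (f : L2 d) :
    tfShift w (tfShift z f) = expTwoPiI (-inner ℝ z.2 w.1) • tfShift (w + z) f := by
  apply Lp.ext
  filter_upwards [coeFn_tfShift w (tfShift z f), coeFn_tfShift (w + z) f,
    Lp.coeFn_smul (expTwoPiI (-inner ℝ z.2 w.1)) (tfShift (w + z) f),
    ae_comp_sub_right w.1 (coeFn_tfShift z f)] with t h1 h2 h3 h4
  rw [h1, h3, Pi.smul_apply, h2, tfShiftFun_apply, h4, tfShiftFun_apply, tfShiftFun_apply,
    smul_eq_mul, ← mul_assoc, ← mul_assoc, ← expTwoPiI_add, ← expTwoPiI_add, Prod.fst_add,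
    Prod.snd_add, sub_sub, inner_sub_right, inner_add_left]
  congr 2
  ring

theorem tfShift_zero (f : L2 d) : tfShift 0 f = f := by
  apply Lp.ext
  filter_upwards [coeFn_tfShift 0 f] with t h
  rw [h, tfShiftFun_apply]
  simp [expTwoPiI_zero]

/-- The symplectic form `σ(w, z) = w₁ · z₂ - w₂ · z₁` of the time-frequency plane. -/
def symplecticForm (d : ℕ) : LinearMap.BilinForm ℝ (PhaseSpace d) :=
  LinearMap.mk₂ ℝ (fun w z => inner ℝ w.1 z.2 - inner ℝ w.2 z.1)
    (fun a b c => by simp only [Prod.fst_add, Prod.snd_add, inner_add_left]; ring)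
    (fun r a b => by
      simp only [Prod.smul_fst, Prod.smul_snd, real_inner_smul_left, smul_eq_mul]; ring)
    (fun a b c => by simp only [Prod.fst_add, Prod.snd_add, inner_add_right]; ring)
    (fun r a b => by
      simp only [Prod.smul_fst, Prod.smul_snd, real_inner_smul_right, smul_eq_mul]; ring)

theorem symplecticForm_apply (w z : PhaseSpace d) :
    symplecticForm d w z = inner ℝ w.1 z.2 - inner ℝ w.2 z.1 := rfl

/-- The phase is trivial for all z ∈ Λ exactly when σ(w, ·) is integral on Λ, which is why Λ°
governs operators commuting with the shifts along Λ. -/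
theorem tfShift_comm (w z : PhaseSpace d) (f : L2 d) :
    tfShift z (tfShift w f) = expTwoPiI (symplecticForm d w z) • tfShift w (tfShift z f) := by
  rw [tfShift_tfShift, tfShift_tfShift, smul_smul, ← expTwoPiI_add, add_comm z w,
    symplecticForm_apply, real_inner_comm z.2 w.1]
  congr 2
  ring

/-- `e^{-2πiσ(w,z)} ⟨f, π(z) g⟩ = ⟨π(w) f, π(z) π(w) g⟩`. -/
theorem pairing_tfShift_comm (w z : PhaseSpace d) (f g : L2 d) :
    pairing (tfShift w f) (tfShift z (tfShift w g)) =
      expTwoPiI (-symplecticForm d w z) * pairing f (tfShift z g) := by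
  rw [tfShift_comm, pairing_smul_right, pairing_tfShift_tfShift, expTwoPiI_neg]

theorem pairing_tfShift_left (z : PhaseSpace d) (f g : L2 d) :
    pairing (tfShift z f) g = expTwoPiI (inner ℝ z.2 z.1) * pairing f (tfShift (-z) g) := by
  rw [← pairing_tfShift_tfShift z f (tfShift (-z) g), tfShift_tfShift, add_neg_cancel, tfShift_zero,
    pairing_smul_right, ← mul_assoc, ← expTwoPiI_neg, ← expTwoPiI_add, Prod.snd_neg, inner_neg_left,
    neg_neg, add_neg_cancel, expTwoPiI_zero, one_mul]

/-- Composition phases are unimodular, so in absolute value a Gram matrix of shifts depends only on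
differences. Schur's test and the convolution inequality both rest on this. -/
theorem norm_pairing_tfShift_tfShift (w z : PhaseSpace d) (f g : L2 d) :
    ‖pairing (tfShift w f) (tfShift z g)‖ = ‖stft g f (z - w)‖ := by
  rw [pairing_tfShift_left, norm_mul, norm_expTwoPiI, one_mul, tfShift_tfShift, pairing_smul_right,
    norm_mul, RCLike.norm_conj, norm_expTwoPiI, one_mul, stft, neg_add_eq_sub]

/-- The phases of `π(-z)` cancel in the product of two matrix coefficients. -/
theorem pairing_tfShift_neg_mul (u z : PhaseSpace d) (f₁ f₂ g h : L2 d) :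
    pairing (tfShift (-z) f₁) (tfShift u g) * pairing (tfShift u h) (tfShift (-z) f₂) =
      pairing f₁ (tfShift (z + u) g) * pairing (tfShift (z + u) h) f₂ := by
  have key : ∀ f g : L2 d, pairing (tfShift (-z) f) (tfShift u g) =
      expTwoPiI (inner ℝ z.2 z.1) * (expTwoPiI (inner ℝ u.2 z.1) *
        pairing f (tfShift (z + u) g)) := by
    intro f g
    rw [pairing_tfShift_left, neg_neg, tfShift_tfShift, pairing_smul_right, ← expTwoPiI_neg,
      neg_neg, Prod.snd_neg, Prod.fst_neg, inner_neg_neg]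
  rw [key f₁ g, ← conj_pairing _ (tfShift u h), key f₂ h, map_mul, map_mul, conj_pairing]
  linear_combination (pairing f₁ (tfShift (z + u) g) * pairing (tfShift (z + u) h) f₂) *
    (conj_expTwoPiI_mul_self (inner ℝ z.2 z.1) + (conj (expTwoPiI (inner ℝ z.2 z.1)) *
      expTwoPiI (inner ℝ z.2 z.1)) * (conj_expTwoPiI_mul_self (inner ℝ u.2 z.1)))

/-! ### Strong continuity -/

theorem tfShift_eq_modulation_translation (z : PhaseSpace d) (f : L2 d) :
    tfShift z f = tfShift (0, z.2) (tfShift (z.1, 0) f) := by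
  rw [tfShift_tfShift]
  simp [expTwoPiI_zero]

theorem tfShift_translation (x : ConfigSpace d) (f : L2 d) :
    tfShift (x, 0) f = DomAddAct.mk (-x) +ᵥ f := by
  apply Lp.ext
  filter_upwards [coeFn_tfShift (x, 0) f, DomAddAct.vadd_Lp_ae_eq (DomAddAct.mk (-x)) f]
    with t h1 h2
  rw [h1, h2, tfShiftFun_apply]
  simp [expTwoPiI_zero, sub_eq_neg_add]

theorem continuous_translation (f : L2 d) :
    Continuous fun x : ConfigSpace d => tfShift (x, 0) f := by
  have : Fact ((1 : ENNReal) ≤ 2) := ⟨one_le_two⟩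
  have : Fact ((2 : ENNReal) ≠ ⊤) := ⟨ENNReal.ofNat_ne_top⟩
  simp only [tfShift_translation]
  have : Continuous fun x : ConfigSpace d => DomAddAct.mk (-x) :=
    DomAddAct.continuous_mk.comp continuous_neg
  fun_prop

theorem continuous_pairing_modulation (f g : L2 d) :
    Continuous fun ω : ConfigSpace d => pairing (tfShift (0, ω) f) g := by
  have : (fun ω : ConfigSpace d => pairing (tfShift (0, ω) f) g) =
      fun ω => ∫ t, expTwoPiI (inner ℝ ω t) * (f t * conj (g t)) := by
    ext ω
    rw [pairing_eq_integral]
    refine integral_congr_ae ?_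
    filter_upwards [coeFn_tfShift (0, ω) f] with t h
    rw [h, tfShiftFun_apply, sub_zero, mul_assoc]
  rw [this]
  have hint : Integrable fun t => f t * conj (g t) := L2.integrable_inner g f
  refine continuous_of_dominated (bound := fun t => ‖f t * conj (g t)‖) ?_ ?_ hint.norm ?_
  · intro ω
    refine AEStronglyMeasurable.mul ?_ hint.aestronglyMeasurable
    exact (continuous_expTwoPiI.comp (by fun_prop)).aestronglyMeasurable
  · intro ω
    refine Eventually.of_forall fun t => ?_
    rw [norm_mul, norm_expTwoPiI, one_mul]
  · refine Eventually.of_forall fun t => ?_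
    exact (continuous_expTwoPiI.comp (by fun_prop)).mul continuous_const

/-- Weak continuity together with constant norm gives strong continuity, by expanding ‖a - b‖². -/
theorem continuous_modulation (f : L2 d) :
    Continuous fun ω : ConfigSpace d => tfShift (0, ω) f := by
  refine continuous_iff_continuousAt.mpr fun ω₀ => tendsto_iff_norm_sub_tendsto_zero.mpr ?_
  have hsq : ∀ ω : ConfigSpace d, ‖tfShift (0, ω) f - tfShift (0, ω₀) f‖ =
      √(2 * ‖f‖ ^ 2 - 2 * (pairing (tfShift (0, ω) f) (tfShift (0, ω₀) f)).re) := by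
    intro ω
    rw [← Real.sqrt_sq (norm_nonneg (tfShift (0, ω) f - tfShift (0, ω₀) f)), @norm_sub_sq ℂ,
      norm_tfShift, norm_tfShift, inner_re_symm]
    congr 1
    simp only [pairing, RCLike.re_to_complex]
    ring
  simp only [hsq]
  have hc : Continuous fun ω : ConfigSpace d =>
      √(2 * ‖f‖ ^ 2 - 2 * (pairing (tfShift (0, ω) f) (tfShift (0, ω₀) f)).re) := by
    have := continuous_pairing_modulation f (tfShift (0, ω₀) f)
    fun_prop
  convert hc.tendsto ω₀ using 2
  rw [pairing_self, norm_tfShift, ← Complex.ofReal_pow, Complex.ofReal_re, sub_self, Real.sqrt_zero]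

theorem continuous_tfShift (f : L2 d) : Continuous fun z : PhaseSpace d => tfShift z f := by
  refine continuous_iff_continuousAt.mpr fun z₀ => tendsto_iff_norm_sub_tendsto_zero.mpr ?_
  have hb : ∀ z : PhaseSpace d, ‖tfShift z f - tfShift z₀ f‖ ≤
      ‖tfShift (z.1, 0) f - tfShift (z₀.1, 0) f‖ +
        ‖tfShift (0, z.2) (tfShift (z₀.1, 0) f) - tfShift (0, z₀.2) (tfShift (z₀.1, 0) f)‖ := by
    intro z
    have h := norm_tfShift (0, z.2) (tfShift (z.1, 0) f - tfShift (z₀.1, 0) f)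
    rw [tfShift_sub, ← tfShift_eq_modulation_translation z] at h
    rw [← h, tfShift_eq_modulation_translation z₀]
    exact norm_sub_le_norm_sub_add_norm_sub _ _ _
  refine squeeze_zero (fun _ => norm_nonneg _) hb ?_
  have hc : Continuous fun z : PhaseSpace d => ‖tfShift (z.1, 0) f - tfShift (z₀.1, 0) f‖ +
        ‖tfShift (0, z.2) (tfShift (z₀.1, 0) f) - tfShift (0, z₀.2) (tfShift (z₀.1, 0) f)‖ :=
    (((continuous_translation f).comp continuous_fst).sub continuous_const).norm.add
      (((continuous_modulation (tfShift (z₀.1, 0) f)).comp continuous_snd).sub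
        continuous_const).norm
  simpa using hc.tendsto z₀

theorem continuous_pairing : Continuous fun p : L2 d × L2 d => pairing p.1 p.2 := by
  unfold pairing
  fun_prop

theorem continuous_stft (g f : L2 d) : Continuous (stft g f) :=
  continuous_pairing.comp (continuous_const.prodMk (continuous_tfShift g))

/-! ### Moyal's identity -/

theorem eLpNorm_two_sq {α : Type*} [MeasurableSpace α] (μ : Measure α) (f : α → ℂ) :
    eLpNorm f 2 μ ^ 2 = ∫⁻ x, ‖f x‖ₑ ^ 2 ∂μ := by
  have h := eLpNorm_nnreal_pow_eq_lintegral (f := f) (μ := μ) (p := 2) two_ne_zero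
  simpa using h

theorem enorm_sq_eq_lintegral (f : L2 d) : ‖f‖ₑ ^ 2 = ∫⁻ t, ‖f t‖ₑ ^ 2 := by
  rw [Lp.enorm_def, eLpNorm_two_sq]

theorem stft_apply (g f : L2 d) (z : PhaseSpace d) :
    stft g f z = ∫ t, expTwoPiI (-inner ℝ z.2 t) * (f t * conj (g (t - z.1))) := by
  rw [stft, pairing_eq_integral]
  refine integral_congr_ae ?_
  filter_upwards [coeFn_tfShift z g] with t h
  rw [h, tfShiftFun_apply, map_mul, expTwoPiI_neg]
  ring

/-- A Schwartz function as an element of `L²(ℝ^d)`. -/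
def schwartzToL2 (f : 𝓢(ConfigSpace d, ℂ)) : L2 d := f.toLp 2

theorem coeFn_schwartzToL2 (f : 𝓢(ConfigSpace d, ℂ)) : schwartzToL2 f =ᵐ[volume] f :=
  f.coeFn_toLp 2 volume

/-- For Schwartz functions `f`, `g`, the Schwartz function `t ↦ f(t) conj(g(t - x))`. -/
def schwartzWindowed (g f : 𝓢(ConfigSpace d, ℂ)) (x : ConfigSpace d) : 𝓢(ConfigSpace d, ℂ) :=
  SchwartzMap.pairing (ContinuousLinearMap.mul ℝ ℂ) f
    (SchwartzMap.postcompCLM (𝕜 := ℝ) (Complex.conjCLE : ℂ →L[ℝ] ℂ)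
      (SchwartzMap.compSubConstCLM ℝ x g))

theorem schwartzWindowed_apply (g f : 𝓢(ConfigSpace d, ℂ)) (x t : ConfigSpace d) :
    schwartzWindowed g f x t = f t * conj (g (t - x)) := by
  simp [schwartzWindowed]

theorem stft_schwartz (g f : 𝓢(ConfigSpace d, ℂ)) (z : PhaseSpace d) :
    stft (schwartzToL2 g) (schwartzToL2 f) z = 𝓕 (schwartzWindowed g f z.1) z.2 := by
  rw [stft_apply, SchwartzMap.fourier_coe, Real.fourier_eq']
  refine integral_congr_ae ?_
  filter_upwards [coeFn_schwartzToL2 f, ae_comp_sub_right z.1 (coeFn_schwartzToL2 g)] with t h1 h2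
  rw [h1, h2, schwartzWindowed_apply, smul_eq_mul, expTwoPiI, real_inner_comm]
  congr 2
  push_cast
  ring

/-- For fixed x the transform is the Fourier transform of f · conj g(· - x). Plancherel in ω, then
Tonelli and translation invariance in x, give the identity. -/
theorem lintegral_stft_schwartz (g f : 𝓢(ConfigSpace d, ℂ)) :
    ∫⁻ z, ‖stft (schwartzToL2 g) (schwartzToL2 f) z‖ₑ ^ 2 =
      ‖schwartzToL2 f‖ₑ ^ 2 * ‖schwartzToL2 g‖ₑ ^ 2 := by
  have hm := (continuous_stft (schwartzToL2 g) (schwartzToL2 f)).measurable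
  have hpl : ∀ x : ConfigSpace d, ∫⁻ ω, ‖stft (schwartzToL2 g) (schwartzToL2 f) (x, ω)‖ₑ ^ 2 =
      ∫⁻ t, ‖f t‖ₑ ^ 2 * ‖g (t - x)‖ₑ ^ 2 := by
    intro x
    have h : ‖schwartzToL2 (𝓕 (schwartzWindowed g f x))‖ₑ ^ 2 =
        ‖schwartzToL2 (schwartzWindowed g f x)‖ₑ ^ 2 := by
      rw [← ofReal_norm, ← ofReal_norm, schwartzToL2, SchwartzMap.norm_fourier_toL2_eq,
        schwartzToL2]
    rw [enorm_sq_eq_lintegral, enorm_sq_eq_lintegral] at h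
    refine (lintegral_congr_ae ?_).trans (h.trans (lintegral_congr_ae ?_))
    · filter_upwards [coeFn_schwartzToL2 (𝓕 (schwartzWindowed g f x))] with ω hω
      rw [hω, stft_schwartz]
    · filter_upwards [coeFn_schwartzToL2 (schwartzWindowed g f x)] with t ht
      rw [ht, schwartzWindowed_apply, enorm_mul, mul_pow, RCLike.enorm_conj]
  have hfm : Measurable fun t => ‖f t‖ₑ ^ 2 := (f.continuous.measurable.enorm).pow_const 2
  have hgm : Measurable fun t => ‖g t‖ₑ ^ 2 := (g.continuous.measurable.enorm).pow_const 2
  rw [Measure.volume_eq_prod, lintegral_prod _ (hm.enorm.pow_const 2).aemeasurable]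
  simp only [hpl]
  rw [lintegral_lintegral_swap]
  · have : ∀ t : ConfigSpace d, ∫⁻ x, ‖f t‖ₑ ^ 2 * ‖g (t - x)‖ₑ ^ 2 =
        ‖f t‖ₑ ^ 2 * ∫⁻ x, ‖g x‖ₑ ^ 2 := by
      intro t
      have hc : Measurable fun x => ‖g (t - x)‖ₑ ^ 2 :=
        hgm.comp (measurable_const.sub measurable_id)
      rw [lintegral_const_mul _ hc, lintegral_sub_left_eq_self (fun x => ‖g x‖ₑ ^ 2)]
    simp only [this]
    rw [lintegral_mul_const _ hfm, enorm_sq_eq_lintegral, enorm_sq_eq_lintegral]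
    congr 1 <;> refine lintegral_congr_ae ?_
    · filter_upwards [coeFn_schwartzToL2 f] with t ht
      rw [ht]
    · filter_upwards [coeFn_schwartzToL2 g] with t ht
      rw [ht]
  · refine Measurable.aemeasurable ?_
    exact (hfm.comp measurable_snd).mul (hgm.comp (measurable_snd.sub measurable_fst))

theorem denseRange_schwartz_pair :
    DenseRange fun p : 𝓢(ConfigSpace d, ℂ) × 𝓢(ConfigSpace d, ℂ) =>
      (schwartzToL2 p.1, schwartzToL2 p.2) := by
  have h := SchwartzMap.denseRange_toLpCLM (E := ConfigSpace d) (F := ℂ) (p := 2) (μ := volume)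
    (by simp)
  exact h.prodMap h

theorem continuous_stft_pair (z : PhaseSpace d) :
    Continuous fun p : L2 d × L2 d => stft p.1 p.2 z :=
  continuous_pairing.comp
    (continuous_snd.prodMk ((tfShiftLI z).continuous.comp continuous_fst))

/-- Fatou's lemma along Schwartz approximations keeps only an inequality. It suffices to place V_g f
in L² and to make it depend continuously on (g, f); equality then follows by density in
`norm_stftLp`. -/
theorem lintegral_stft_le (g f : L2 d) :
    ∫⁻ z, ‖stft g f z‖ₑ ^ 2 ≤ ‖f‖ₑ ^ 2 * ‖g‖ₑ ^ 2 := by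
  have hcl : IsClosed {p : L2 d × L2 d | ∫⁻ z, ‖stft p.1 p.2 z‖ₑ ^ 2 ≤
      ‖p.2‖ₑ ^ 2 * ‖p.1‖ₑ ^ 2} := by
    refine IsSeqClosed.isClosed fun p q hp hpq => ?_
    have h1 : ∀ z, Tendsto (fun n => ‖stft (p n).1 (p n).2 z‖ₑ ^ 2) atTop
        (𝓝 (‖stft q.1 q.2 z‖ₑ ^ 2)) := fun z =>
      ((ENNReal.continuous_pow 2).comp (continuous_stft_pair z).enorm).continuousAt.tendsto.comp hpq
    have h2 : Tendsto (fun n => ‖(p n).2‖ₑ ^ 2 * ‖(p n).1‖ₑ ^ 2) atTop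
        (𝓝 (‖q.2‖ₑ ^ 2 * ‖q.1‖ₑ ^ 2)) := by
      refine ENNReal.Tendsto.mul ?_ (Or.inr (by finiteness)) ?_ (Or.inr (by finiteness))
      · exact ((ENNReal.continuous_pow 2).comp continuous_snd.enorm).continuousAt.tendsto.comp hpq
      · exact ((ENNReal.continuous_pow 2).comp continuous_fst.enorm).continuousAt.tendsto.comp hpq
    calc ∫⁻ z, ‖stft q.1 q.2 z‖ₑ ^ 2
        = ∫⁻ z, liminf (fun n => ‖stft (p n).1 (p n).2 z‖ₑ ^ 2) atTop :=
          lintegral_congr fun z => (h1 z).liminf_eq.symm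
      _ ≤ liminf (fun n => ∫⁻ z, ‖stft (p n).1 (p n).2 z‖ₑ ^ 2) atTop :=
          lintegral_liminf_le fun n => ((continuous_stft _ _).measurable.enorm).pow_const 2
      _ ≤ liminf (fun n => ‖(p n).2‖ₑ ^ 2 * ‖(p n).1‖ₑ ^ 2) atTop :=
          liminf_le_liminf (Eventually.of_forall hp)
      _ = ‖q.2‖ₑ ^ 2 * ‖q.1‖ₑ ^ 2 := h2.liminf_eq
  exact denseRange_schwartz_pair.induction_on (p := fun p => ∫⁻ z, ‖stft p.1 p.2 z‖ₑ ^ 2 ≤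
      ‖p.2‖ₑ ^ 2 * ‖p.1‖ₑ ^ 2) (g, f) hcl fun p => (lintegral_stft_schwartz p.1 p.2).le

theorem memLp_stft (g f : L2 d) : MemLp (stft g f) 2 (volume : Measure (PhaseSpace d)) := by
  refine ⟨(continuous_stft g f).aestronglyMeasurable, ?_⟩
  have h : eLpNorm (stft g f) 2 volume ^ 2 < ⊤ := by
    rw [eLpNorm_two_sq]
    exact (lintegral_stft_le g f).trans_lt (by finiteness)
  simpa [ENNReal.pow_lt_top_iff] using h

/-- The short-time Fourier transform as an element of `L²(ℝ^{2d})`. -/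
def stftLp (g f : L2 d) : Lp ℂ 2 (volume : Measure (PhaseSpace d)) := (memLp_stft g f).toLp _

theorem enorm_stftLp_sq (g f : L2 d) : ‖stftLp g f‖ₑ ^ 2 = ∫⁻ z, ‖stft g f z‖ₑ ^ 2 := by
  rw [stftLp, Lp.enorm_toLp, eLpNorm_two_sq]

theorem norm_stftLp_le (g f : L2 d) : ‖stftLp g f‖ ≤ ‖f‖ * ‖g‖ := by
  have h := lintegral_stft_le g f
  rw [← enorm_stftLp_sq, ← mul_pow, ENNReal.pow_le_pow_left_iff two_ne_zero, ← enorm_norm,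
    ← enorm_norm f, ← enorm_norm g, ← enorm_mul] at h
  rw [← abs_of_nonneg (norm_nonneg (stftLp g f)),
    ← abs_of_nonneg (mul_nonneg (norm_nonneg f) (norm_nonneg g))]
  exact enorm_le_iff_norm_le.mp h

theorem stftLp_add_right (g f₁ f₂ : L2 d) : stftLp g (f₁ + f₂) = stftLp g f₁ + stftLp g f₂ := by
  rw [stftLp, stftLp, stftLp, ← MemLp.toLp_add]
  congr 1
  ext z
  exact pairing_add_left _ _ _

theorem stftLp_smul_right (c : ℂ) (g f : L2 d) : stftLp g (c • f) = c • stftLp g f := by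
  rw [stftLp, stftLp, ← MemLp.toLp_const_smul]
  congr 1
  ext z
  exact pairing_smul_left _ _ _

theorem stftLp_add_left (g₁ g₂ f : L2 d) : stftLp (g₁ + g₂) f = stftLp g₁ f + stftLp g₂ f := by
  rw [stftLp, stftLp, stftLp, ← MemLp.toLp_add]
  congr 1
  ext z
  rw [stft, tfShift_add]
  exact pairing_add_right _ _ _

theorem stftLp_smul_left (c : ℂ) (g f : L2 d) : stftLp (c • g) f = conj c • stftLp g f := by
  rw [stftLp, stftLp, ← MemLp.toLp_const_smul]
  congr 1
  ext z
  rw [stft, tfShift_smul]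
  exact pairing_smul_right _ _ _

theorem stftLp_sub_right (g f₁ f₂ : L2 d) : stftLp g (f₁ - f₂) = stftLp g f₁ - stftLp g f₂ := by
  rw [eq_sub_iff_add_eq, ← stftLp_add_right, sub_add_cancel]

theorem stftLp_sub_left (g₁ g₂ f : L2 d) : stftLp (g₁ - g₂) f = stftLp g₁ f - stftLp g₂ f := by
  rw [eq_sub_iff_add_eq, ← stftLp_add_left, sub_add_cancel]

theorem continuous_stftLp : Continuous fun p : L2 d × L2 d => stftLp p.1 p.2 := by
  refine continuous_iff_continuousAt.mpr fun q => tendsto_iff_norm_sub_tendsto_zero.mpr ?_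
  have hb : ∀ p : L2 d × L2 d, ‖stftLp p.1 p.2 - stftLp q.1 q.2‖ ≤
      ‖p.2 - q.2‖ * ‖p.1‖ + ‖q.2‖ * ‖p.1 - q.1‖ := by
    intro p
    have : stftLp p.1 p.2 - stftLp q.1 q.2 =
        stftLp p.1 (p.2 - q.2) + stftLp (p.1 - q.1) q.2 := by
      rw [stftLp_sub_right, stftLp_sub_left]
      abel
    rw [this]
    exact (norm_add_le _ _).trans (add_le_add (norm_stftLp_le _ _) (norm_stftLp_le _ _))
  refine squeeze_zero (fun _ => norm_nonneg _) hb ?_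
  have hc : Continuous fun p : L2 d × L2 d =>
      ‖p.2 - q.2‖ * ‖p.1‖ + ‖q.2‖ * ‖p.1 - q.1‖ := by fun_prop
  simpa using hc.tendsto q

theorem norm_stftLp (g f : L2 d) : ‖stftLp g f‖ = ‖f‖ * ‖g‖ := by
  have hd := denseRange_schwartz_pair (d := d)
  have hcl : IsClosed {p : L2 d × L2 d | ‖stftLp p.1 p.2‖ = ‖p.2‖ * ‖p.1‖} :=
    isClosed_eq continuous_stftLp.norm (by fun_prop)
  refine hd.induction_on (p := fun p => ‖stftLp p.1 p.2‖ = ‖p.2‖ * ‖p.1‖) (g, f) hcl fun p => ?_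
  have h := lintegral_stft_schwartz p.1 p.2
  rw [← enorm_stftLp_sq, ← mul_pow, (ENNReal.pow_right_strictMono two_ne_zero).injective.eq_iff] at h
  simpa using congrArg ENNReal.toReal h

theorem inner_stftLp_same_window (g f₁ f₂ : L2 d) :
    inner ℂ (stftLp g f₁) (stftLp g f₂) = inner ℂ f₁ f₂ * inner ℂ g g := by
  rw [inner_eq_sum_norm_sq_div_four, inner_eq_sum_norm_sq_div_four f₁ f₂,
    inner_self_eq_norm_sq_to_K]
  simp only [← stftLp_smul_right, ← stftLp_add_right, ← stftLp_sub_right, norm_stftLp,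
    RCLike.ofReal_mul]
  ring

theorem inner_stftLp (g₁ g₂ f₁ f₂ : L2 d) :
    inner ℂ (stftLp g₁ f₁) (stftLp g₂ f₂) = inner ℂ f₁ f₂ * inner ℂ g₂ g₁ := by
  have h := fun g : L2 d => inner_stftLp_same_window g f₁ f₂
  have h1 := h (g₁ + g₂)
  have h3 := h (g₁ + Complex.I • g₂)
  simp only [stftLp_add_left, stftLp_smul_left, inner_add_left, inner_add_right, inner_smul_left,
    inner_smul_right, h g₁, h g₂, Complex.conj_I, map_neg] at h1 h3
  -- Polarization in the windows: `h1` gives the sum of the two cross terms, `h3` their difference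
  -- up to a factor of i, and these weights isolate one of them.
  linear_combination (norm := (ring_nf; simp only [Complex.I_sq]; ring)) h1 / 2 + Complex.I / 2 * h3

/-- **Moyal's identity**, or the orthogonality relations of the short-time Fourier transform. -/
theorem integral_stft_mul_conj_stft (g₁ g₂ f₁ f₂ : L2 d) :
    ∫ z, stft g₁ f₁ z * conj (stft g₂ f₂ z) = pairing f₁ f₂ * pairing g₂ g₁ := by
  have h := inner_stftLp g₂ g₁ f₂ f₁
  rw [L2.inner_def] at h
  rw [pairing, pairing, ← h]
  refine integral_congr_ae ?_
  filter_upwards [(memLp_stft g₁ f₁).coeFn_toLp, (memLp_stft g₂ f₂).coeFn_toLp] with z h1 h2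
  rw [stftLp, stftLp, h1, h2]
  rfl

theorem integrable_stft_mul_conj_stft (g₁ g₂ f₁ f₂ : L2 d) :
    Integrable fun z => stft g₁ f₁ z * conj (stft g₂ f₂ z) :=
  (memLp_stft g₁ f₁).integrable_mul (memLp_stft g₂ f₂).star

/-! ### The Gaussian window -/

/-- The real Gaussian `e^{-a(|x|² + |ω|²)}` on the time-frequency plane. -/
def phaseGaussian (a : ℝ) (z : PhaseSpace d) : ℝ :=
  Real.exp (-a * ‖z.1‖ ^ 2) * Real.exp (-a * ‖z.2‖ ^ 2)

@[fun_prop]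
theorem measurable_phaseGaussian (a : ℝ) : Measurable (phaseGaussian a : PhaseSpace d → ℝ) := by
  unfold phaseGaussian
  fun_prop

theorem integrable_exp_neg_mul_sq_norm {V : Type*} [NormedAddCommGroup V] [InnerProductSpace ℝ V]
    [FiniteDimensional ℝ V] [MeasurableSpace V] [BorelSpace V] {a : ℝ} (ha : 0 < a) :
    Integrable fun v : V => Real.exp (-a * ‖v‖ ^ 2) := by
  have h := (GaussianFourier.integrable_cexp_neg_mul_sq_norm_add (V := V) (b := (a : ℂ))
    (by simpa using ha) 0 0).re
  refine h.congr (Eventually.of_forall fun v => ?_)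
  simp only [zero_mul, add_zero]
  rw [← Complex.exp_ofReal_re]
  push_cast
  rfl

theorem integrable_phaseGaussian {a : ℝ} (ha : 0 < a) :
    Integrable (phaseGaussian a : PhaseSpace d → ℝ) :=
  (integrable_exp_neg_mul_sq_norm ha).mul_prod (integrable_exp_neg_mul_sq_norm ha)

theorem memLp_gaussian :
    MemLp (fun t : ConfigSpace d => ((Real.exp (-Real.pi * ‖t‖ ^ 2) : ℝ) : ℂ)) 2 volume := by
  refine (memLp_two_iff_integrable_sq_norm (by fun_prop)).mpr ?_
  refine (integrable_exp_neg_mul_sq_norm (a := 2 * Real.pi) (by positivity)).congr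
    (Eventually.of_forall fun t => ?_)
  simp only [Complex.norm_real, Real.norm_eq_abs, Real.abs_exp, ← Real.exp_nat_mul]
  congr 1
  push_cast
  ring

/-- The Gaussian `e^{-π|t|²}` as an element of `L²(ℝ^d)`. -/
def gaussianWindow (d : ℕ) : L2 d := memLp_gaussian.toLp _

theorem coeFn_gaussianWindow : gaussianWindow d =ᵐ[volume]
    fun t => ((Real.exp (-Real.pi * ‖t‖ ^ 2) : ℝ) : ℂ) := memLp_gaussian.coeFn_toLp

theorem gaussianWindow_ne_zero : gaussianWindow d ≠ 0 := by
  intro h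
  have h1 := coeFn_gaussianWindow (d := d)
  rw [h] at h1
  have h2 : ∀ᵐ t : ConfigSpace d, False := by
    filter_upwards [h1, Lp.coeFn_zero ℂ 2 (volume : Measure (ConfigSpace d))] with t ht ht0
    rw [ht0] at ht
    exact Real.exp_ne_zero _ (Complex.ofReal_eq_zero.mp ht.symm)
  simp [NeZero.ne (volume : Measure (ConfigSpace d))] at h2

theorem exists_norm_stft_gaussianWindow : ∃ C : ℝ, ∀ z : PhaseSpace d,
    ‖stft (gaussianWindow d) (gaussianWindow d) z‖ = C * phaseGaussian (Real.pi / 2) z := by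
  refine ⟨‖((Real.pi : ℂ) / (2 * Real.pi : ℝ)) ^ (Module.finrank ℝ (ConfigSpace d) / 2 : ℂ)‖,
    fun z => ?_⟩
  have h1 : stft (gaussianWindow d) (gaussianWindow d) z =
      ∫ t, expTwoPiI (-inner ℝ z.2 t) *
        ((Real.exp (-Real.pi * ‖t‖ ^ 2 - Real.pi * ‖t - z.1‖ ^ 2) : ℝ) : ℂ) := by
    rw [stft_apply]
    refine integral_congr_ae ?_
    filter_upwards [coeFn_gaussianWindow, ae_comp_sub_right z.1 coeFn_gaussianWindow]
      with t h1 h2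
    rw [h1, h2, Complex.conj_ofReal, ← Complex.ofReal_mul, ← Real.exp_add]
    congr 4
    ring
  -- Recentring at the midpoint x/2 turns the product of the two Gaussians into e^{-π|x|²/2}
  -- e^{-2π|t|²}, by the parallelogram law.
  have h2 : ∀ t : ConfigSpace d, expTwoPiI (-inner ℝ z.2 (t + (1 / 2 : ℝ) • z.1)) *
      ((Real.exp (-Real.pi * ‖t + (1 / 2 : ℝ) • z.1‖ ^ 2 -
        Real.pi * ‖t + (1 / 2 : ℝ) • z.1 - z.1‖ ^ 2) : ℝ) : ℂ) =
      (expTwoPiI (-inner ℝ z.2 ((1 / 2 : ℝ) • z.1)) *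
        (Real.exp (-(Real.pi / 2) * ‖z.1‖ ^ 2) : ℝ)) *
        (Complex.exp (↑(-2 * Real.pi * inner ℝ t z.2) * Complex.I) •
          Complex.exp (-(2 * Real.pi : ℝ) * (‖t‖ : ℂ) ^ 2)) := by
    intro t
    have e1 : t + (1 / 2 : ℝ) • z.1 - z.1 = t - (1 / 2 : ℝ) • z.1 := by module
    have e2 : -Real.pi * ‖t + (1 / 2 : ℝ) • z.1‖ ^ 2 - Real.pi * ‖t - (1 / 2 : ℝ) • z.1‖ ^ 2 =
        -(Real.pi / 2) * ‖z.1‖ ^ 2 + -(2 * Real.pi) * ‖t‖ ^ 2 := by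
      rw [norm_add_sq_real, norm_sub_sq_real, norm_smul, Real.norm_of_nonneg (by norm_num)]
      ring
    rw [e1, e2, Real.exp_add, inner_add_right, neg_add, expTwoPiI_add, real_inner_comm t z.2,
      smul_eq_mul]
    have e3 : expTwoPiI (-inner ℝ t z.2) =
        Complex.exp (↑(-2 * Real.pi * inner ℝ t z.2) * Complex.I) := by
      rw [expTwoPiI]
      congr 1
      push_cast
      ring
    rw [e3]
    push_cast
    ring
  rw [h1, ← integral_add_right_eq_self _ ((1 / 2 : ℝ) • z.1)]
  simp only [h2]
  rw [integral_const_mul, ← Real.fourier_eq', fourier_gaussian_innerProductSpace (by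
    simpa using Real.pi_pos), norm_mul, norm_mul, norm_mul, norm_expTwoPiI, Complex.norm_real,
    Real.norm_of_nonneg (Real.exp_pos _).le, one_mul, phaseGaussian, Complex.norm_exp]
  have e4 : (-(Real.pi : ℂ) ^ 2 * (‖z.2‖ : ℂ) ^ 2 / ((2 * Real.pi : ℝ) : ℂ)).re =
      -(Real.pi / 2) * ‖z.2‖ ^ 2 := by
    have : (-(Real.pi : ℂ) ^ 2 * (‖z.2‖ : ℂ) ^ 2 / ((2 * Real.pi : ℝ) : ℂ)) =
      ((-(Real.pi / 2) * ‖z.2‖ ^ 2 : ℝ) : ℂ) := by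
      have := Real.pi_ne_zero
      push_cast
      field_simp
    rw [this, Complex.ofReal_re]
  rw [e4]
  ring

/-! ### Functions with bounded periodization -/

/-- The periodization of the nonnegative function `G` along `L` is bounded. -/
def BoundedPeriodization (L : Submodule ℤ (PhaseSpace d)) (G : PhaseSpace d → ℝ≥0∞) : Prop :=
  ∃ K : ℝ≥0∞, K ≠ ⊤ ∧ ∀ u, ∑' z : L, G (u + z) ≤ K

namespace BoundedPeriodization

variable {L : Submodule ℤ (PhaseSpace d)} {G : PhaseSpace d → ℝ≥0∞}

theorem const_mul (hG : BoundedPeriodization L G) {c : ℝ≥0∞} (hc : c ≠ ⊤) :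
    BoundedPeriodization L fun z => c * G z := by
  obtain ⟨K, hK, h⟩ := hG
  refine ⟨c * K, ENNReal.mul_ne_top hc hK, fun u => ?_⟩
  rw [ENNReal.tsum_mul_left]
  gcongr
  exact h u

theorem comp_sub (hG : BoundedPeriodization L G) (w : PhaseSpace d) :
    BoundedPeriodization L fun z => G (z - w) := by
  obtain ⟨K, hK, h⟩ := hG
  refine ⟨K, hK, fun u => ?_⟩
  simpa only [add_sub_right_comm] using h (u - w)

theorem comp_neg (hG : BoundedPeriodization L G) : BoundedPeriodization L fun z => G (-z) := by
  obtain ⟨K, hK, h⟩ := hG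
  refine ⟨K, hK, fun u => ?_⟩
  rw [← (Equiv.neg L).tsum_eq]
  simpa [add_comm] using h (-u)

theorem mono {H : PhaseSpace d → ℝ≥0∞} (hG : BoundedPeriodization L G) (hH : ∀ z, H z ≤ G z) :
    BoundedPeriodization L H := by
  obtain ⟨K, hK, h⟩ := hG
  exact ⟨K, hK, fun u => (ENNReal.tsum_le_tsum fun _ => hH _).trans (h u)⟩

/-- By Tonelli, periodizing F ∗ G amounts to convolving F with the periodization of G. The bound on
the latter must be uniform in u, not just at u = 0. -/
theorem convolution [Countable L] (hG : BoundedPeriodization L G) (hGm : Measurable G)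
    {F : PhaseSpace d → ℝ≥0∞} (hFm : Measurable F) (hF : ∫⁻ z, F z ≠ ⊤) :
    BoundedPeriodization L fun w => ∫⁻ z, F z * G (w - z) := by
  obtain ⟨K, hK, h⟩ := hG
  refine ⟨(∫⁻ z, F z) * K, ENNReal.mul_ne_top hF hK, fun u => ?_⟩
  rw [← lintegral_tsum fun w => by fun_prop, ← lintegral_mul_const _ hFm]
  refine lintegral_mono fun z => ?_
  rw [ENNReal.tsum_mul_left]
  gcongr
  simpa only [add_sub_right_comm] using h (u - z)

end BoundedPeriodization

instance instIsAddHaarMeasurePhaseSpace :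
    (volume : Measure (PhaseSpace d)).IsAddHaarMeasure :=
  inferInstanceAs (((volume : Measure (ConfigSpace d)).prod volume).IsAddHaarMeasure)

section Lattice

variable {ι : Type*} [Finite ι] (b : Module.Basis ι ℝ (PhaseSpace d))

theorem lintegral_eq_lintegral_tsum_add (F : PhaseSpace d → ℝ≥0∞) (hF : Measurable F) :
    ∫⁻ z, F z = ∫⁻ u in ZSpan.fundamentalDomain b,
      ∑' z : Submodule.span ℤ (Set.range b), F (u + z) := by
  have : VAddInvariantMeasure (Submodule.span ℤ (Set.range b)) (PhaseSpace d) volume :=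
    inferInstanceAs (VAddInvariantMeasure
      (Submodule.span ℤ (Set.range b)).toAddSubgroup (PhaseSpace d) volume)
  have := (ZSpan.isAddFundamentalDomain b (volume : Measure (PhaseSpace d))).lintegral_eq_tsum'' F
  rw [this, lintegral_tsum fun z => by fun_prop]
  refine tsum_congr fun z => lintegral_congr fun u => ?_
  rw [add_comm]
  rfl

theorem volume_fundamentalDomain_lt_top :
    volume (ZSpan.fundamentalDomain b) < (⊤ : ℝ≥0∞) :=
  (ZSpan.fundamentalDomain_isBounded b).measure_lt_top

/-- Each value is dominated by an average of a wider Gaussian over a translated fundamental domain.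
Summed over the lattice, these averages reassemble into one integral over the whole plane. -/
theorem boundedPeriodization_phaseGaussian {a : ℝ} (ha : 0 < a) :
    BoundedPeriodization (Submodule.span ℤ (Set.range b))
      fun z => ENNReal.ofReal (phaseGaussian a z) := by
  obtain ⟨R, hR⟩ := (ZSpan.fundamentalDomain_isBounded b).exists_norm_le
  -- Halving a absorbs the factor in ‖x + y‖² ≤ 2R² + 2‖y‖²; the two coordinates together contribute
  -- (a/2) · 4R² = 2aR².
  have hpt : ∀ v u : PhaseSpace d, u ∈ ZSpan.fundamentalDomain b →
      phaseGaussian a v ≤ Real.exp (2 * a * R ^ 2) * phaseGaussian (a / 2) (u + v) := by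
    intro v u hu
    have h1 : ∀ x y : ConfigSpace d, ‖x‖ ≤ R → ‖x + y‖ ^ 2 ≤ 2 * R ^ 2 + 2 * ‖y‖ ^ 2 := by
      intro x y hx
      nlinarith [norm_add_le x y, norm_nonneg (x + y), norm_nonneg x, norm_nonneg y,
        sq_nonneg (‖x‖ - ‖y‖)]
    have h2 := h1 u.1 v.1 ((norm_fst_le u).trans (hR u hu))
    have h3 := h1 u.2 v.2 ((norm_snd_le u).trans (hR u hu))
    rw [phaseGaussian, phaseGaussian, ← Real.exp_add, ← Real.exp_add, ← Real.exp_add,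
      Real.exp_le_exp, Prod.fst_add, Prod.snd_add]
    nlinarith
  set V := volume (ZSpan.fundamentalDomain b) with hV
  have hV0 : V ≠ 0 := ZSpan.measure_fundamentalDomain_ne_zero b
  have hVt : V ≠ ⊤ := (volume_fundamentalDomain_lt_top b).ne
  set C := ENNReal.ofReal (Real.exp (2 * a * R ^ 2)) with hC
  set I := ∫⁻ z : PhaseSpace d, ENNReal.ofReal (phaseGaussian (a / 2) z) with hI
  have hIt : I ≠ ⊤ := (integrable_phaseGaussian (half_pos ha)).lintegral_lt_top.ne
  refine ⟨V⁻¹ * (C * I), ENNReal.mul_ne_top (ENNReal.inv_ne_top.mpr hV0)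
    (ENNReal.mul_ne_top ENNReal.ofReal_ne_top hIt), fun w => ?_⟩
  rw [← ENNReal.mul_le_iff_le_inv hV0 hVt, ← ENNReal.tsum_mul_left]
  have hstep : ∀ z : PhaseSpace d, V * ENNReal.ofReal (phaseGaussian a (w + z)) ≤
      ∫⁻ u in ZSpan.fundamentalDomain b,
        C * ENNReal.ofReal (phaseGaussian (a / 2) (u + z + w)) := by
    intro z
    rw [mul_comm, hV, ← setLIntegral_const]
    refine setLIntegral_mono (by fun_prop) fun u hu => ?_
    rw [hC, ← ENNReal.ofReal_mul (Real.exp_pos _).le, add_assoc, add_comm z w]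
    exact ENNReal.ofReal_le_ofReal (hpt _ _ hu)
  refine (ENNReal.tsum_le_tsum
    fun z : Submodule.span ℤ (Set.range b) => hstep (z : PhaseSpace d)).trans ?_
  rw [← lintegral_tsum fun z => by fun_prop, hI,
    ← lintegral_add_right_eq_self (fun z => ENNReal.ofReal (phaseGaussian (a / 2) z)) w,
    lintegral_eq_lintegral_tsum_add b _ (by fun_prop), ← lintegral_const_mul _ ?_]
  · simp only [ENNReal.tsum_mul_left, le_refl]
  · exact Measurable.tsum fun z => by fun_prop

theorem BoundedPeriodization.lintegral_ne_top {G : PhaseSpace d → ℝ≥0∞} (hGm : Measurable G)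
    (hG : BoundedPeriodization (Submodule.span ℤ (Set.range b)) G) : ∫⁻ z, G z ≠ ⊤ := by
  obtain ⟨K, hK, h⟩ := hG
  rw [lintegral_eq_lintegral_tsum_add b G hGm]
  refine ne_top_of_le_ne_top
    (ENNReal.mul_ne_top hK (volume_fundamentalDomain_lt_top b).ne) ?_
  rw [← setLIntegral_const]
  exact lintegral_mono fun u => h u

/-! ### Sampling the short-time Fourier transform of functions in Feichtinger's algebra -/

theorem measurable_enorm_stft (g f : L2 d) : Measurable fun z => ‖stft g f z‖ₑ :=
  (continuous_stft g f).measurable.enorm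

/-- Moyal's identity with π(w)φ as second function is a reproducing formula for V_φ f; absolute
values turn it into a convolution bound. -/
theorem enorm_stft_mul_le (φ f g₁ g₂ : L2 d) (w : PhaseSpace d) :
    ‖pairing g₂ g₁‖ₑ * ‖stft φ f w‖ₑ ≤ ∫⁻ z, ‖stft g₁ f z‖ₑ * ‖stft φ g₂ (w - z)‖ₑ := by
  have h := integral_stft_mul_conj_stft g₁ g₂ f (tfShift w φ)
  rw [← enorm_mul, mul_comm, stft, ← h]
  refine (enorm_integral_le_lintegral_enorm _).trans (lintegral_mono fun z => ?_)
  rw [enorm_mul, RCLike.enorm_conj, stft, stft, ← ofReal_norm (pairing (tfShift w φ) _),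
    norm_pairing_comm, norm_pairing_tfShift_tfShift, ofReal_norm]

theorem norm_stft_neg (g f : L2 d) (z : PhaseSpace d) : ‖stft g f (-z)‖ = ‖stft f g z‖ := by
  have h := norm_pairing_tfShift_tfShift z 0 f g
  rw [zero_sub, tfShift_zero, norm_pairing_comm] at h
  exact h.symm

theorem boundedPeriodization_stft_of_reproducing (φ f g₁ g₂ : L2 d) (hne : pairing g₂ g₁ ≠ 0)
    (h1 : ∫⁻ z, ‖stft g₁ f z‖ₑ ≠ ⊤) {L : Submodule ℤ (PhaseSpace d)} [Countable L]
    (h2 : BoundedPeriodization L fun z => ‖stft φ g₂ z‖ₑ) :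
    BoundedPeriodization L fun z => ‖stft φ f z‖ₑ := by
  have hc := (h2.convolution (measurable_enorm_stft φ g₂) (measurable_enorm_stft g₁ f) h1).const_mul
    (c := ‖pairing g₂ g₁‖ₑ⁻¹) (by simpa using hne)
  refine hc.mono fun w => ?_
  rw [← ENNReal.mul_le_iff_le_inv (by simpa using hne) (by finiteness)]
  exact enorm_stft_mul_le φ f g₁ g₂ w

theorem exists_stft_ne_zero {φ f : L2 d} (hφ : φ ≠ 0) (hf : f ≠ 0) : ∃ z, stft φ f z ≠ 0 := by
  by_contra! h
  have h1 : stftLp φ f = 0 := by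
    rw [stftLp, ← MemLp.toLp_zero (MemLp.zero : MemLp (0 : PhaseSpace d → ℂ) 2 volume)]
    congr 1
    exact funext h
  have h2 := norm_stftLp φ f
  rw [h1, norm_zero, eq_comm, mul_eq_zero, norm_eq_zero, norm_eq_zero] at h2
  exact h2.elim hf hφ

theorem boundedPeriodization_stft_gaussianWindow_self :
    BoundedPeriodization (Submodule.span ℤ (Set.range b))
      fun z => ‖stft (gaussianWindow d) (gaussianWindow d) z‖ₑ := by
  obtain ⟨C, hC⟩ := exists_norm_stft_gaussianWindow (d := d)
  refine ((boundedPeriodization_phaseGaussian b (half_pos Real.pi_pos)).const_mul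
    (c := ENNReal.ofReal C) ENNReal.ofReal_ne_top).mono fun z => ?_
  rw [← ofReal_norm, hC, ENNReal.ofReal_mul' (by unfold phaseGaussian; positivity)]

/-- Membership in M¹ controls only V_g g, so g itself is the reproducing window. Since g may be
orthogonal to the Gaussian, the Gaussian is first moved to a point z₀ where V g does not vanish. -/
theorem boundedPeriodization_stft_gaussianWindow {g : L2 d} (hg : g ∈ feichtingerAlgebra d) :
    BoundedPeriodization (Submodule.span ℤ (Set.range b))
      fun z => ‖stft (gaussianWindow d) g z‖ₑ := by
  by_cases h0 : g = 0
  · refine ⟨0, by simp, fun u => ?_⟩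
    have : ∀ z, stft (gaussianWindow d) (0 : L2 d) z = 0 := fun z => inner_zero_right _
    simp [h0, this]
  obtain ⟨z₀, hz₀⟩ := exists_stft_ne_zero gaussianWindow_ne_zero h0
  refine boundedPeriodization_stft_of_reproducing (gaussianWindow d) g g
    (tfShift z₀ (gaussianWindow d)) ?_ ?_ ?_
  · rw [← conj_pairing]
    simpa [stft] using hz₀
  · exact hg.2.ne
  · refine ((boundedPeriodization_stft_gaussianWindow_self b).comp_sub z₀).mono fun z => ?_
    rw [stft, ← ofReal_norm, norm_pairing_tfShift_tfShift, ofReal_norm]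

/-- The Gaussian φ is now the intermediate window: V_φ h is integrable by the previous bound, and
|V_g φ| is the reflection of |V_φ g|. -/
theorem boundedPeriodization_stft {g h : L2 d} (hg : g ∈ feichtingerAlgebra d)
    (hh : h ∈ feichtingerAlgebra d) :
    BoundedPeriodization (Submodule.span ℤ (Set.range b)) fun z => ‖stft g h z‖ₑ := by
  refine boundedPeriodization_stft_of_reproducing g h (gaussianWindow d) (gaussianWindow d) ?_ ?_ ?_
  · rw [pairing_self]
    simpa using gaussianWindow_ne_zero
  · exact (boundedPeriodization_stft_gaussianWindow b hh).lintegral_ne_top b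
      (measurable_enorm_stft _ _)
  · refine (boundedPeriodization_stft_gaussianWindow b hg).comp_neg.mono fun z => ?_
    rw [← ofReal_norm, ← ofReal_norm, norm_stft_neg]

theorem summable_norm_stft {g h : L2 d} (hg : g ∈ feichtingerAlgebra d)
    (hh : h ∈ feichtingerAlgebra d) :
    Summable fun z : Submodule.span ℤ (Set.range b) => ‖stft g h z‖ := by
  obtain ⟨K, hK, hs⟩ := boundedPeriodization_stft b hg hh
  have h0 := ne_top_of_le_ne_top hK (hs 0)
  simp only [zero_add] at h0
  exact (ENNReal.summable_toReal h0).congr fun z => by simp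

end Lattice

/-! ### Bessel bounds and the frame operator -/

section Bessel

variable {L : Submodule ℤ (PhaseSpace d)}

/-- Schur's test for the Gram matrix of the shifts π(z)g: its entries have modulus |V_g g(z - w)|,
so every row and column sum is at most the full lattice sum. -/
theorem norm_sum_smul_tfShift_sq_le {g : L2 d} (hg : Summable fun z : L => ‖stft g g z‖)
    (c : L → ℂ) (s : Finset L) :
    ‖∑ z ∈ s, c z • tfShift (z : PhaseSpace d) g‖ ^ 2 ≤
      (∑' z : L, ‖stft g g z‖) * ∑ z ∈ s, ‖c z‖ ^ 2 := by
  have hrow : ∀ w : L, ∑ z ∈ s, ‖stft g g ((z : PhaseSpace d) - w)‖ ≤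
      ∑' z : L, ‖stft g g z‖ := by
    intro w
    rw [← (Equiv.subRight w).tsum_eq fun z : L => ‖stft g g z‖]
    exact ((Equiv.subRight w).summable_iff.mpr hg).sum_le_tsum s fun _ _ => norm_nonneg _
  have hcol : ∀ z : L, ∑ w ∈ s, ‖stft g g ((z : PhaseSpace d) - w)‖ ≤
      ∑' z : L, ‖stft g g z‖ := by
    intro z
    refine le_of_eq_of_le (Finset.sum_congr rfl fun w _ => ?_) (hrow z)
    rw [← norm_stft_neg, neg_sub]
  calc ‖∑ z ∈ s, c z • tfShift (z : PhaseSpace d) g‖ ^ 2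
      = ‖pairing (∑ w ∈ s, c w • tfShift (w : PhaseSpace d) g)
          (∑ z ∈ s, c z • tfShift (z : PhaseSpace d) g)‖ := by
        rw [pairing_self, norm_pow, Complex.norm_real, norm_norm]
    _ ≤ ∑ z ∈ s, ∑ w ∈ s, ‖c z‖ * ‖c w‖ * ‖stft g g ((z : PhaseSpace d) - w)‖ := by
        rw [pairing, sum_inner]
        refine (norm_sum_le _ _).trans (Finset.sum_le_sum fun z _ => ?_)
        rw [inner_sum]
        refine (norm_sum_le _ _).trans (Finset.sum_le_sum fun w _ => le_of_eq ?_)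
        rw [inner_smul_left, inner_smul_right, norm_mul, norm_mul, RCLike.norm_conj, ← mul_assoc,
          ← norm_pairing_tfShift_tfShift, pairing]
    _ ≤ ∑ z ∈ s, ∑ w ∈ s, (‖c z‖ ^ 2 / 2 * ‖stft g g ((z : PhaseSpace d) - w)‖ +
          ‖c w‖ ^ 2 / 2 * ‖stft g g ((z : PhaseSpace d) - w)‖) := by
        refine Finset.sum_le_sum fun z _ => Finset.sum_le_sum fun w _ => ?_
        rw [← add_mul]
        gcongr
        linarith [two_mul_le_add_sq ‖c z‖ ‖c w‖]
    _ = ∑ z ∈ s, ‖c z‖ ^ 2 / 2 * ∑ w ∈ s, ‖stft g g ((z : PhaseSpace d) - w)‖ +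
          ∑ w ∈ s, ‖c w‖ ^ 2 / 2 * ∑ z ∈ s, ‖stft g g ((z : PhaseSpace d) - w)‖ := by
        simp only [Finset.sum_add_distrib, Finset.mul_sum]
        congr 1
        exact Finset.sum_comm
    _ ≤ ∑ z ∈ s, ‖c z‖ ^ 2 / 2 * (∑' z : L, ‖stft g g z‖) +
          ∑ w ∈ s, ‖c w‖ ^ 2 / 2 * (∑' z : L, ‖stft g g z‖) := by
        gcongr with z _ w _
        · exact hcol z
        · exact hrow w
    _ = (∑' z : L, ‖stft g g z‖) * ∑ z ∈ s, ‖c z‖ ^ 2 := by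
        rw [← Finset.sum_add_distrib, Finset.mul_sum]
        exact Finset.sum_congr rfl fun z _ => by ring

/-- Duality with the synthesis bound: the sum X equals ⟨f, v⟩ with ‖v‖² ≤ A X, so X² ≤ A‖f‖² X.
Working on a finite set makes X finite and the cancellation legitimate. -/
theorem sum_norm_stft_sq_le {g : L2 d} (hg : Summable fun z : L => ‖stft g g z‖) (f : L2 d)
    (s : Finset L) :
    ∑ z ∈ s, ‖stft g f z‖ ^ 2 ≤ (∑' z : L, ‖stft g g z‖) * ‖f‖ ^ 2 := by
  set X := ∑ z ∈ s, ‖stft g f z‖ ^ 2 with hX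
  set A := ∑' z : L, ‖stft g g z‖ with hA
  set v := ∑ z ∈ s, stft g f z • tfShift (z : PhaseSpace d) g with hv
  have hX0 : 0 ≤ X := Finset.sum_nonneg fun _ _ => by positivity
  have hA0 : 0 ≤ A := tsum_nonneg fun _ => norm_nonneg _
  have h1 : (X : ℂ) = pairing f v := by
    rw [hv, pairing, sum_inner, hX, Complex.ofReal_sum]
    refine Finset.sum_congr rfl fun z _ => ?_
    rw [inner_smul_left, Complex.ofReal_pow, ← Complex.conj_mul']
    rfl
  have h2 : X ≤ ‖f‖ * ‖v‖ := by
    have := norm_pairing_le f v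
    rwa [← h1, Complex.norm_real, Real.norm_of_nonneg hX0] at this
  have h3 : ‖v‖ ^ 2 ≤ A * X := norm_sum_smul_tfShift_sq_le hg (fun z => stft g f z) s
  have h4 : X * X ≤ A * ‖f‖ ^ 2 * X := by
    calc X * X ≤ (‖f‖ * ‖v‖) * (‖f‖ * ‖v‖) := mul_self_le_mul_self hX0 h2
      _ = ‖f‖ ^ 2 * ‖v‖ ^ 2 := by ring
      _ ≤ ‖f‖ ^ 2 * (A * X) := by gcongr
      _ = A * ‖f‖ ^ 2 * X := by ring
  rcases hX0.eq_or_lt with h0 | h0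
  · rw [← h0]
    positivity
  · exact le_of_mul_le_mul_right h4 h0

theorem summable_norm_stft_sq {g : L2 d} (hg : Summable fun z : L => ‖stft g g z‖) (f : L2 d) :
    Summable fun z : L => ‖stft g f z‖ ^ 2 :=
  summable_of_sum_le (fun _ => by positivity) (sum_norm_stft_sq_le hg f)

theorem tsum_norm_stft_sq_le {g : L2 d} (hg : Summable fun z : L => ‖stft g g z‖) (f : L2 d) :
    ∑' z : L, ‖stft g f z‖ ^ 2 ≤ (∑' z : L, ‖stft g g z‖) * ‖f‖ ^ 2 :=
  (summable_norm_stft_sq hg f).tsum_le_of_sum_le (sum_norm_stft_sq_le hg f)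

theorem summable_smul_tfShift {h : L2 d} (hh : Summable fun z : L => ‖stft h h z‖) {c : L → ℂ}
    (hc : Summable fun z => ‖c z‖ ^ 2) :
    Summable fun z : L => c z • tfShift (z : PhaseSpace d) h := by
  set A := ∑' z : L, ‖stft h h z‖ with hA
  have hA0 : 0 ≤ A := tsum_nonneg fun _ => norm_nonneg _
  refine summable_iff_vanishing_norm.mpr fun ε hε => ?_
  -- The + 1 covers the case A = 0.
  obtain ⟨s, hs⟩ := summable_iff_vanishing_norm.mp hc (ε ^ 2 / (A + 1)) (by positivity)
  refine ⟨s, fun t ht => ?_⟩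
  have h1 := norm_sum_smul_tfShift_sq_le hh c t
  have h2 := (le_abs_self _).trans_lt (hs t ht)
  rw [lt_div_iff₀ (by positivity)] at h2
  have h3 : 0 ≤ ∑ z ∈ t, ‖c z‖ ^ 2 := Finset.sum_nonneg fun _ _ => by positivity
  refine lt_of_pow_lt_pow_left₀ 2 hε.le ?_
  nlinarith

theorem norm_tsum_smul_tfShift_sq_le {h : L2 d} (hh : Summable fun z : L => ‖stft h h z‖)
    {c : L → ℂ} (hc : Summable fun z => ‖c z‖ ^ 2) :
    ‖∑' z : L, c z • tfShift (z : PhaseSpace d) h‖ ^ 2 ≤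
      (∑' z : L, ‖stft h h z‖) * ∑' z, ‖c z‖ ^ 2 :=
  le_of_tendsto_of_tendsto ((summable_smul_tfShift hh hc).hasSum.norm.pow 2)
    (hc.hasSum.const_mul _ |>.congr fun s => by rw [Finset.mul_sum])
    (Eventually.of_forall fun s => norm_sum_smul_tfShift_sq_le hh c s)

/-- The frame operator `f ↦ ∑_{z ∈ L} ⟨f, π(z) g⟩ π(z) h` of one pair of windows. -/
def frameOperator {g h : L2 d} (hg : Summable fun z : L => ‖stft g g z‖)
    (hh : Summable fun z : L => ‖stft h h z‖) : L2 d →L[ℂ] L2 d :=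
  LinearMap.mkContinuous
    { toFun := fun f => ∑' z : L, stft g f z • tfShift (z : PhaseSpace d) h
      map_add' := fun f₁ f₂ => by
        rw [← (summable_smul_tfShift hh (summable_norm_stft_sq hg f₁)).tsum_add
          (summable_smul_tfShift hh (summable_norm_stft_sq hg f₂))]
        refine tsum_congr fun z => ?_
        rw [← add_smul]
        congr 1
        exact pairing_add_left _ _ _
      map_smul' := fun c f => by
        rw [RingHom.id_apply,
          ← (summable_smul_tfShift hh (summable_norm_stft_sq hg f)).tsum_const_smul c]
        refine tsum_congr fun z => ?_
        rw [smul_smul]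
        congr 1
        exact pairing_smul_left _ _ _ }
    (√((∑' z : L, ‖stft h h z‖) * ∑' z : L, ‖stft g g z‖)) (by
      intro f
      have h0 : ∀ k : L2 d, 0 ≤ ∑' z : L, ‖stft k k z‖ := fun k => tsum_nonneg fun _ => norm_nonneg _
      have h1 := norm_tsum_smul_tfShift_sq_le hh (summable_norm_stft_sq hg f)
      have h2 := mul_le_mul_of_nonneg_left (tsum_norm_stft_sq_le hg f) (h0 h)
      refine (sq_le_sq₀ (norm_nonneg _) (by positivity)).mp (h1.trans (h2.trans_eq ?_))
      rw [mul_pow, Real.sq_sqrt (mul_nonneg (h0 h) (h0 g)), mul_assoc])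

theorem hasSum_frameOperator {g h : L2 d} (hg : Summable fun z : L => ‖stft g g z‖)
    (hh : Summable fun z : L => ‖stft h h z‖) (f : L2 d) :
    HasSum (fun z : L => stft g f z • tfShift (z : PhaseSpace d) h) (frameOperator hg hh f) :=
  (summable_smul_tfShift hh (summable_norm_stft_sq hg f)).hasSum

theorem HasSum.pairing_left {α : Type*} {u : α → L2 d} {v : L2 d} (hu : HasSum u v) (k : L2 d) :
    HasSum (fun a => pairing (u a) k) (pairing v k) :=
  hu.mapL (innerSL ℂ k)

theorem hasSum_pairing_frameOperator {g h : L2 d} (hg : Summable fun z : L => ‖stft g g z‖)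
    (hh : Summable fun z : L => ‖stft h h z‖) (f₁ f₂ : L2 d) :
    HasSum (fun z : L => pairing f₁ (tfShift (z : PhaseSpace d) g) *
      pairing (tfShift (z : PhaseSpace d) h) f₂) (pairing (frameOperator hg hh f₁) f₂) :=
  ((hasSum_frameOperator hg hh f₁).pairing_left f₂).congr_fun fun z => by
    rw [pairing_smul_left, stft]

/-- The periodization of `z ↦ ⟨f₁, π(z) g⟩ ⟨π(z) h, f₂⟩` is a matrix coefficient of the frame
operator. -/
theorem hasSum_periodization {g h : L2 d} (hg : Summable fun z : L => ‖stft g g z‖)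
    (hh : Summable fun z : L => ‖stft h h z‖) (f₁ f₂ : L2 d) (u : PhaseSpace d) :
    HasSum (fun z : L => stft g f₁ (u + z) * conj (stft h f₂ (u + z)))
      (pairing (frameOperator hg hh (tfShift (-u) f₁)) (tfShift (-u) f₂)) :=
  (hasSum_pairing_frameOperator hg hh (tfShift (-u) f₁) (tfShift (-u) f₂)).congr_fun fun z => by
    rw [pairing_tfShift_neg_mul, stft, stft, conj_pairing]

/-- Continuity is read off the operator formula, so no uniform convergence of the periodization
series is needed. -/
theorem continuous_periodization {g h : L2 d} (hg : Summable fun z : L => ‖stft g g z‖)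
    (hh : Summable fun z : L => ‖stft h h z‖) (f₁ f₂ : L2 d) :
    Continuous fun u : PhaseSpace d =>
      pairing (frameOperator hg hh (tfShift (-u) f₁)) (tfShift (-u) f₂) :=
  continuous_pairing.comp
    (((frameOperator hg hh).continuous.comp ((continuous_tfShift f₁).comp continuous_neg)).prodMk
      ((continuous_tfShift f₂).comp continuous_neg))

end Bessel

/-! ### Fourier series of functions periodic along a lattice -/

section FourierSeries

variable {ι : Type*} [Fintype ι] (b : Module.Basis ι ℝ (PhaseSpace d))

/-- The linear coordinates `(ι → ℝ) → ℝ^{2d}` of a basis, as a continuous linear equivalence. -/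
def coordEquiv : (ι → ℝ) ≃L[ℝ] PhaseSpace d := b.equivFun.symm.toContinuousLinearEquiv

theorem coordEquiv_apply (x : ι → ℝ) : coordEquiv b x = ∑ i, x i • b i :=
  b.equivFun_symm_apply x

theorem repr_coordEquiv (x : ι → ℝ) (i : ι) : b.repr (coordEquiv b x) i = x i := by
  change b.repr (b.equivFun.symm x) i = x i
  rw [← b.equivFun_apply, LinearEquiv.apply_symm_apply]

theorem coordEquiv_preimage_fundamentalDomain :
    coordEquiv b ⁻¹' ZSpan.fundamentalDomain b = Set.univ.pi fun _ => Set.Ico 0 1 := by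
  ext x
  simp only [Set.mem_preimage, ZSpan.mem_fundamentalDomain, Set.mem_univ_pi]
  exact forall_congr' fun i => by rw [repr_coordEquiv]

/-- Both sides are Haar measures; the scalar is found on the fundamental domain, whose preimage is
the unit cube. -/
theorem map_coordEquiv_volume :
    (volume : Measure (ι → ℝ)).map (coordEquiv b) =
      (volume (ZSpan.fundamentalDomain b))⁻¹ • (volume : Measure (PhaseSpace d)) := by
  have : ((volume : Measure (ι → ℝ)).map (coordEquiv b)).IsAddHaarMeasure :=
    (coordEquiv b).isAddHaarMeasure_map _
  have h := Measure.isAddLeftInvariant_eq_smul ((volume : Measure (ι → ℝ)).map (coordEquiv b))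
    (volume : Measure (PhaseSpace d))
  have h1 := congrArg (fun μ : Measure (PhaseSpace d) => μ (ZSpan.fundamentalDomain b)) h
  simp only [Measure.smul_apply] at h1
  rw [Measure.map_apply (coordEquiv b).continuous.measurable (ZSpan.fundamentalDomain_measurableSet b),
    coordEquiv_preimage_fundamentalDomain, Real.volume_pi_Ico] at h1
  simp only [sub_zero, ENNReal.ofReal_one, Finset.prod_const_one, ENNReal.smul_def,
    smul_eq_mul] at h1
  rw [h, ← ENNReal.eq_inv_of_mul_eq_one_left h1.symm]
  rfl

theorem setIntegral_unitCube_comp_coordEquiv (F : PhaseSpace d → ℂ) :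
    ∫ x in {x : ι → ℝ | ∀ i, x i ∈ Set.Ioc (0 : ℝ) (0 + 1)}, F (coordEquiv b x) =
      ((volume.real (ZSpan.fundamentalDomain b) : ℝ) : ℂ)⁻¹ *
        ∫ z in ZSpan.fundamentalDomain b, F z := by
  -- The torus coefficients are integrals over `Ioc` cubes and the fundamental domain is an `Ico`
  -- cube; they differ by a null set.
  have hae : {x : ι → ℝ | ∀ i, x i ∈ Set.Ioc (0 : ℝ) (0 + 1)} =ᵐ[volume]
      coordEquiv b ⁻¹' ZSpan.fundamentalDomain b := by
    have h1 := Measure.univ_pi_Ioc_ae_eq_Icc (μ := fun _ : ι => (volume : Measure ℝ))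
      (f := fun _ => 0) (g := fun _ => 1)
    have h2 := Measure.univ_pi_Ico_ae_eq_Icc (μ := fun _ : ι => (volume : Measure ℝ))
      (f := fun _ => 0) (g := fun _ => 1)
    have h3 : {x : ι → ℝ | ∀ i, x i ∈ Set.Ioc (0 : ℝ) (0 + 1)} =
        Set.univ.pi fun _ => Set.Ioc 0 1 := by
      ext x
      simp
    rw [coordEquiv_preimage_fundamentalDomain, h3]
    exact h1.trans h2.symm
  have he : MeasurableEmbedding (coordEquiv b) := (coordEquiv b).toHomeomorph.measurableEmbedding
  rw [setIntegral_congr_set hae, ← he.setIntegral_map, map_coordEquiv_volume, Measure.restrict_smul, integral_smul_measure, ENNReal.toReal_inv,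
    Complex.real_smul, Complex.ofReal_inv]
  rfl

theorem isOpenQuotientMap_unitAddTorus_mk {ι : Type*} :
    IsOpenQuotientMap fun (x : ι → ℝ) (i : ι) => (x i : UnitAddCircle) :=
  IsOpenQuotientMap.piMap fun _ => QuotientAddGroup.isOpenQuotientMap_mk

theorem mFourier_coe (n : ι → ℤ) (x : ι → ℝ) :
    UnitAddTorus.mFourier n (fun i => (x i : UnitAddCircle)) = expTwoPiI (∑ i, n i * x i) := by
  simp only [UnitAddTorus.mFourier, ContinuousMap.coe_mk, fourier_coe_apply]
  rw [expTwoPiI, ← Complex.exp_sum]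
  congr 1
  push_cast
  rw [Finset.mul_sum]
  exact Finset.sum_congr rfl fun i _ => by ring

theorem coordEquiv_intCast_mem (n : ι → ℤ) :
    coordEquiv b (fun i => (n i : ℝ)) ∈ Submodule.span ℤ (Set.range b) := by
  rw [coordEquiv_apply]
  refine Submodule.sum_mem _ fun i _ => ?_
  rw [Int.cast_smul_eq_zsmul]
  exact Submodule.smul_mem _ _ (Submodule.subset_span ⟨i, rfl⟩)

/-- A continuous function on `ℝ^{2d}` that is periodic along the lattice spanned by `b` descends
to the torus. -/
theorem exists_continuousMap_unitAddTorus {P : PhaseSpace d → ℂ} (hP : Continuous P)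
    (hper : ∀ u, ∀ z ∈ Submodule.span ℤ (Set.range b), P (u + z) = P u) :
    ∃ Q : C(UnitAddTorus ι, ℂ), ∀ x : ι → ℝ,
      Q (fun i => (x i : UnitAddCircle)) = P (coordEquiv b x) := by
  have hq := isOpenQuotientMap_unitAddTorus_mk (ι := ι)
  have hlift : ∀ x y : ι → ℝ, (fun i => (x i : UnitAddCircle)) = (fun i => (y i : UnitAddCircle)) →
      P (coordEquiv b x) = P (coordEquiv b y) := by
    intro x y hxy
    have h1 : ∀ i, ∃ k : ℤ, (k : ℝ) = y i - x i := by
      intro i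
      have h2 := QuotientAddGroup.eq.mp (congrFun hxy i)
      obtain ⟨k, hk⟩ := AddSubgroup.mem_zmultiples_iff.mp h2
      exact ⟨k, by rw [← neg_add_eq_sub, ← hk]; simp⟩
    choose n hn using h1
    have h3 : y = x + fun i => (n i : ℝ) := by
      ext i
      rw [Pi.add_apply, hn]
      ring
    rw [h3, map_add]
    exact (hper _ _ (coordEquiv_intCast_mem b n)).symm
  -- The section s need not be continuous; continuity of P ∘ s is tested after composing with the
  -- quotient map.
  let s := Function.surjInv hq.surjective
  have hs : ∀ x : ι → ℝ, P (coordEquiv b (s fun i => (x i : UnitAddCircle))) =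
      P (coordEquiv b x) := fun x => hlift _ _ (Function.surjInv_eq hq.surjective _)
  refine ⟨⟨fun y => P (coordEquiv b (s y)), ?_⟩, hs⟩
  rw [hq.isQuotientMap.continuous_iff]
  exact (hP.comp (coordEquiv b).continuous).congr fun x => (hs x).symm

/-- The Fourier coefficients of a function that is periodic along the lattice spanned by `b`. -/
def latticeFourierCoeff (P : PhaseSpace d → ℂ) (n : ι → ℤ) : ℂ :=
  ((volume.real (ZSpan.fundamentalDomain b) : ℝ) : ℂ)⁻¹ *
    ∫ z in ZSpan.fundamentalDomain b, expTwoPiI (-∑ i, n i * b.repr z i) * P z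

theorem mFourierCoeff_eq_latticeFourierCoeff {P : PhaseSpace d → ℂ} {Q : C(UnitAddTorus ι, ℂ)}
    (hQ : ∀ x : ι → ℝ, Q (fun i => (x i : UnitAddCircle)) = P (coordEquiv b x)) (n : ι → ℤ) :
    UnitAddTorus.mFourierCoeff Q n = latticeFourierCoeff b P n := by
  rw [UnitAddTorus.mFourierCoeff_eq_integral Q n fun _ => 0, latticeFourierCoeff,
    ← setIntegral_unitCube_comp_coordEquiv b]
  refine integral_congr_ae (Eventually.of_forall fun x => ?_)
  simp only [hQ, smul_eq_mul, mFourier_coe]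
  congr 2
  rw [← Finset.sum_neg_distrib]
  refine Finset.sum_congr rfl fun i _ => ?_
  rw [repr_coordEquiv, Pi.neg_apply, Int.cast_neg, neg_mul]

/-- A continuous function on the torus with summable coefficients is the pointwise sum of its
Fourier series, and every character equals 1 at 0. -/
theorem hasSum_latticeFourierCoeff {P : PhaseSpace d → ℂ} (hP : Continuous P)
    (hper : ∀ u, ∀ z ∈ Submodule.span ℤ (Set.range b), P (u + z) = P u)
    (hs : Summable (latticeFourierCoeff b P)) : HasSum (latticeFourierCoeff b P) (P 0) := by
  obtain ⟨Q, hQ⟩ := exists_continuousMap_unitAddTorus b hP hper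
  have hc := funext (mFourierCoeff_eq_latticeFourierCoeff b hQ)
  have h := UnitAddTorus.hasSum_mFourier_series_apply_of_summable (f := Q) (hc ▸ hs)
    fun i => ((0 : ℝ) : UnitAddCircle)
  have h0 := hQ fun _ => 0
  simp only [mFourier_coe, mul_zero, Finset.sum_const_zero, expTwoPiI_zero, smul_eq_mul,
    mul_one, hc] at h
  rw [h0, coordEquiv_apply] at h
  simpa using h

theorem latticeFourierCoeff_const (c : ℂ) (n : ι → ℤ) :
    latticeFourierCoeff b (fun _ => c) n = if n = 0 then c else 0 := by
  classical
  have h := mFourierCoeff_eq_latticeFourierCoeff b (P := fun _ => c)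
    (Q := c • UnitAddTorus.mFourier 0) (fun x => by simp [UnitAddTorus.mFourier_zero]) n
  rw [← h, ← UnitAddTorus.mFourierCoeff_toLp, ← UnitAddTorus.mFourierBasis_repr, map_smul, map_smul]
  have h2 := UnitAddTorus.mFourierBasis.repr_self (0 : ι → ℤ)
  rw [UnitAddTorus.coe_mFourierBasis] at h2
  rw [h2, lp.coeFn_smul, Pi.smul_apply, lp.single_apply]
  simp [Pi.single_apply]

/-- Integrals over `ℝ^{2d}` unfold to a fundamental domain. -/
theorem integral_eq_setIntegral_tsum {F : PhaseSpace d → ℂ} (hF : Integrable F)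
    (hFm : Measurable F) :
    ∫ z, F z = ∫ u in ZSpan.fundamentalDomain b,
      ∑' z : Submodule.span ℤ (Set.range b), F (u + z) := by
  have : VAddInvariantMeasure (Submodule.span ℤ (Set.range b)) (PhaseSpace d) volume :=
    inferInstanceAs (VAddInvariantMeasure
      (Submodule.span ℤ (Set.range b)).toAddSubgroup (PhaseSpace d) volume)
  rw [integral_tsum]
  · rw [(ZSpan.isAddFundamentalDomain b (volume : Measure (PhaseSpace d))).integral_eq_tsum'' F hF]
    refine tsum_congr fun z => integral_congr_ae (Eventually.of_forall fun u => ?_)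
    simp only
    rw [add_comm]
    rfl
  · exact fun z => (hFm.comp (measurable_id.add_const _)).aestronglyMeasurable
  · rw [← lintegral_tsum fun z => by fun_prop,
      ← lintegral_eq_lintegral_tsum_add b (fun z => ‖F z‖ₑ) hFm.enorm]
    exact hF.2.ne

/-- An integer-frequency character is constant along lattice translates, so it passes inside the
periodization and the integral over the domain unfolds to the whole plane. -/
theorem latticeFourierCoeff_periodization {F P : PhaseSpace d → ℂ} (hF : Integrable F)
    (hFm : Measurable F)
    (hP : ∀ u, HasSum (fun z : Submodule.span ℤ (Set.range b) => F (u + z)) (P u)) (n : ι → ℤ) :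
    latticeFourierCoeff b P n = ((volume.real (ZSpan.fundamentalDomain b) : ℝ) : ℂ)⁻¹ *
      ∫ z, expTwoPiI (-∑ i, n i * b.repr z i) * F z := by
  have hcont : Continuous fun z : PhaseSpace d => expTwoPiI (-∑ i, n i * b.repr z i) := by
    refine continuous_expTwoPiI.comp (continuous_neg.comp (continuous_finsetSum _ fun i _ => ?_))
    exact continuous_const.mul (LinearMap.continuous_of_finiteDimensional (b.coord i))
  have hint : Integrable fun z => expTwoPiI (-∑ i, n i * b.repr z i) * F z :=
    hF.bdd_mul hcont.aestronglyMeasurable (c := 1)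
      (Eventually.of_forall fun z => (norm_expTwoPiI _).le)
  rw [latticeFourierCoeff, integral_eq_setIntegral_tsum b hint (hcont.measurable.mul hFm)]
  congr 1
  refine integral_congr_ae (Eventually.of_forall fun u => ?_)
  simp only
  rw [← (hP u).tsum_eq, ← tsum_mul_left]
  refine tsum_congr fun z => ?_
  congr 1
  have hz : ∀ i, ∃ k : ℤ, (k : ℝ) = b.repr z i := fun i =>
    (b.mem_span_iff_repr_mem ℤ (z : PhaseSpace d)).mp z.2 i
  choose m hm using hz
  have : -∑ i, n i * b.repr (u + z) i =
      -∑ i, n i * b.repr u i + ((-∑ i, n i * m i : ℤ) : ℝ) := by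
    push_cast
    simp only [hm, map_add, Finsupp.add_apply, mul_add, Finset.sum_add_distrib]
    ring
  rw [this, expTwoPiI_add, expTwoPiI_intCast, mul_one]

end FourierSeries

/-! ### The adjoint lattice -/

theorem nondegenerate_symplecticForm : (symplecticForm d).Nondegenerate := by
  constructor
  · intro w hw
    have h1 := hw (-w.2, w.1)
    rw [symplecticForm_apply, inner_neg_right, sub_neg_eq_add, real_inner_self_eq_norm_sq,
      real_inner_self_eq_norm_sq, add_eq_zero_iff_of_nonneg (by positivity) (by positivity)] at h1
    exact Prod.ext (by simpa using h1.1) (by simpa using h1.2)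
  · intro w hw
    have h1 := hw (w.2, -w.1)
    rw [symplecticForm_apply, inner_neg_left, sub_neg_eq_add, real_inner_self_eq_norm_sq,
      real_inner_self_eq_norm_sq, add_eq_zero_iff_of_nonneg (by positivity) (by positivity)] at h1
    exact Prod.ext (by simpa using h1.2) (by simpa using h1.1)

theorem symplecticForm_symplecticJ (v z : PhaseSpace d) :
    symplecticForm d (symplecticJ d v) z = phaseDot v z := by
  rw [symplecticForm_apply, phaseDot]
  simp [symplecticJ, add_comm]

/-- Since σ(Jv, z) = v · z, applying J converts Euclidean duality into symplectic duality. A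
symplectic dual basis then spans Λ°, so the sampling bounds for M¹ apply on Λ° as well. -/
theorem adjointLattice_eq_dualSubmodule (Λ : Submodule ℤ (PhaseSpace d)) :
    adjointLattice Λ = (symplecticForm d).dualSubmodule Λ := by
  have hint : ∀ s : ℝ, (s ∈ (1 : Submodule ℤ ℝ)) ↔ ∃ k : ℤ, s = k := by
    intro s
    rw [Submodule.mem_one]
    simp [eq_comm]
  ext w
  rw [LinearMap.BilinForm.mem_dualSubmodule]
  simp only [hint]
  constructor
  · rintro ⟨v, hv, rfl⟩ z hz
    rw [symplecticForm_symplecticJ]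
    exact hv z hz
  · intro hw
    have hJ : symplecticJ d (-w.2, w.1) = w := by simp [symplecticJ]
    refine ⟨(-w.2, w.1), fun z hz => ?_, hJ⟩
    rw [← symplecticForm_symplecticJ, hJ]
    exact hw z hz

section Basis

variable {ι : Type*} [Fintype ι] (b : Module.Basis ι ℝ (PhaseSpace d))

open Classical in
/-- The basis dual to `b` for the symplectic form. -/
def symplecticDualBasis : Module.Basis ι ℝ (PhaseSpace d) :=
  (symplecticForm d).dualBasis nondegenerate_symplecticForm b

theorem adjointLattice_span :
    adjointLattice (Submodule.span ℤ (Set.range b)) =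
      Submodule.span ℤ (Set.range (symplecticDualBasis b)) := by
  classical
  rw [adjointLattice_eq_dualSubmodule, symplecticDualBasis,
    LinearMap.BilinForm.dualSubmodule_span_of_basis]

/-- The parametrization of the adjoint lattice by integer vectors. -/
def adjointLatticeEquiv : (ι → ℤ) ≃+ adjointLattice (Submodule.span ℤ (Set.range b)) :=
  ((symplecticDualBasis b).restrictScalars ℤ).equivFun.symm.toAddEquiv.trans
    (LinearEquiv.ofEq _ _ (adjointLattice_span b).symm).toAddEquiv

theorem coe_adjointLatticeEquiv (n : ι → ℤ) :
    (adjointLatticeEquiv b n : PhaseSpace d) = ∑ i, (n i : ℝ) • symplecticDualBasis b i := by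
  have h : (adjointLatticeEquiv b n : PhaseSpace d) =
      ((((symplecticDualBasis b).restrictScalars ℤ).equivFun.symm n :
        Submodule.span ℤ (Set.range (symplecticDualBasis b))) : PhaseSpace d) := rfl
  rw [h, Module.Basis.equivFun_symm_apply, Submodule.coe_sum]
  refine Finset.sum_congr rfl fun i _ => ?_
  rw [Submodule.coe_smul, Module.Basis.restrictScalars_apply, Int.cast_smul_eq_zsmul]

/-- This matches the n-th torus frequency with the character σ(w, ·) of the corresponding w ∈ Λ°. -/
theorem symplecticForm_adjointLatticeEquiv (n : ι → ℤ) (z : PhaseSpace d) :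
    symplecticForm d (adjointLatticeEquiv b n) z = ∑ i, n i * b.repr z i := by
  classical
  have key : ∀ i, symplecticForm d (symplecticDualBasis b i) z = b.repr z i := by
    intro i
    conv_lhs => rw [← b.sum_repr z]
    simp only [map_sum, map_smul, symplecticDualBasis, LinearMap.BilinForm.apply_dualBasis_left]
    simp
  rw [coe_adjointLatticeEquiv, map_sum, LinearMap.sum_apply]
  exact Finset.sum_congr rfl fun i _ => by rw [map_smul, LinearMap.smul_apply, key, smul_eq_mul]

theorem summable_norm_stft_adjointLattice {g h : L2 d} (hg : g ∈ feichtingerAlgebra d)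
    (hh : h ∈ feichtingerAlgebra d) :
    Summable fun w : adjointLattice (Submodule.span ℤ (Set.range b)) => ‖stft g h w‖ := by
  rw [adjointLattice_span]
  exact summable_norm_stft (symplecticDualBasis b) hg hh

theorem summable_pairing_mul {g h : L2 d} (hg : g ∈ feichtingerAlgebra d)
    (hh : h ∈ feichtingerAlgebra d) (f₁ f₂ : L2 d) :
    Summable fun w : adjointLattice (Submodule.span ℤ (Set.range b)) =>
      pairing h (tfShift (w : PhaseSpace d) g) * pairing (tfShift (w : PhaseSpace d) f₁) f₂ := by
  refine .of_norm_bounded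
    ((summable_norm_stft_adjointLattice b hg hh).mul_right (‖f₁‖ * ‖f₂‖)) fun w => ?_
  rw [norm_mul]
  refine mul_le_mul_of_nonneg_left ?_ (norm_nonneg _)
  simpa only [norm_tfShift] using norm_pairing_le (tfShift (w : PhaseSpace d) f₁) f₂

/-! ### The fundamental identity -/

/-- The character is absorbed by replacing f₁ and g with π(w)f₁ and π(w)g; Moyal's identity does the
rest. -/
theorem integral_character_mul_stft (w : PhaseSpace d) (f₁ f₂ g h : L2 d) :
    ∫ z, expTwoPiI (-symplecticForm d w z) * (stft g f₁ z * conj (stft h f₂ z)) =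
      pairing h (tfShift w g) * pairing (tfShift w f₁) f₂ := by
  rw [mul_comm (pairing h _), ← integral_stft_mul_conj_stft]
  refine integral_congr_ae (Eventually.of_forall fun z => ?_)
  simp only
  rw [← mul_assoc, stft, ← pairing_tfShift_comm, ← stft]

theorem latticeFourierCoeff_frameOperator {M : ℕ} {g h : Fin M → L2 d}
    (hg : ∀ i, Summable fun z : Submodule.span ℤ (Set.range b) => ‖stft (g i) (g i) z‖)
    (hh : ∀ i, Summable fun z : Submodule.span ℤ (Set.range b) => ‖stft (h i) (h i) z‖)
    (f₁ f₂ : L2 d) (n : ι → ℤ) :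
    latticeFourierCoeff b (fun u => ∑ i,
        pairing (frameOperator (hg i) (hh i) (tfShift (-u) f₁)) (tfShift (-u) f₂)) n =
      ((volume.real (ZSpan.fundamentalDomain b) : ℝ) : ℂ)⁻¹ *
        ∑ i, pairing (h i) (tfShift (adjointLatticeEquiv b n : PhaseSpace d) (g i)) *
          pairing (tfShift (adjointLatticeEquiv b n : PhaseSpace d) f₁) f₂ := by
  have hint := fun i => integrable_stft_mul_conj_stft (g i) (h i) f₁ f₂
  have hcont : ∀ i, Continuous fun z => stft (g i) f₁ z * conj (stft (h i) f₂ z) := fun i =>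
    (continuous_stft _ _).mul (Complex.continuous_conj.comp (continuous_stft _ _))
  rw [latticeFourierCoeff_periodization b
    (F := fun z => ∑ i, stft (g i) f₁ z * conj (stft (h i) f₂ z))
    (integrable_finsetSum _ fun i _ => hint i)
    (continuous_finsetSum _ fun i _ => hcont i).measurable
    fun u => hasSum_sum fun i _ => hasSum_periodization (hg i) (hh i) f₁ f₂ u]
  congr 1
  simp only [← symplecticForm_adjointLatticeEquiv, Finset.mul_sum]
  rw [integral_finsetSum _ fun i _ => ?_]
  · exact Finset.sum_congr rfl fun i _ => integral_character_mul_stft _ _ _ _ _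
  · refine (hint i).bdd_mul (c := 1) ?_ (Eventually.of_forall fun z => (norm_expTwoPiI _).le)
    refine (continuous_expTwoPiI.comp (continuous_neg.comp ?_)).aestronglyMeasurable
    exact LinearMap.continuous_of_finiteDimensional (symplecticForm d _)

variable {M : ℕ} {g h : Fin M → L2 d}

/-- The fundamental identity: the Fourier series of the periodization, evaluated at u = 0 and
reindexed from integer vectors to Λ°. -/
theorem hasSum_pairing_adjointLattice (hg : ∀ i, g i ∈ feichtingerAlgebra d)
    (hh : ∀ i, h i ∈ feichtingerAlgebra d)
    (hg' : ∀ i, Summable fun z : Submodule.span ℤ (Set.range b) => ‖stft (g i) (g i) z‖)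
    (hh' : ∀ i, Summable fun z : Submodule.span ℤ (Set.range b) => ‖stft (h i) (h i) z‖)
    (f₁ f₂ : L2 d) :
    HasSum (fun w : adjointLattice (Submodule.span ℤ (Set.range b)) =>
      ((volume.real (ZSpan.fundamentalDomain b) : ℝ) : ℂ)⁻¹ *
        ∑ i, pairing (h i) (tfShift (w : PhaseSpace d) (g i)) *
          pairing (tfShift (w : PhaseSpace d) f₁) f₂)
      (∑ i, pairing (frameOperator (hg' i) (hh' i) f₁) f₂) := by
  have hsum : Summable fun w : adjointLattice (Submodule.span ℤ (Set.range b)) =>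
      ((volume.real (ZSpan.fundamentalDomain b) : ℝ) : ℂ)⁻¹ *
        ∑ i, pairing (h i) (tfShift (w : PhaseSpace d) (g i)) *
          pairing (tfShift (w : PhaseSpace d) f₁) f₂ := by
    refine (summable_sum fun i _ => ?_).mul_left _
    exact summable_pairing_mul b (hg i) (hh i) f₁ f₂
  have hc := fun n => latticeFourierCoeff_frameOperator b hg' hh' f₁ f₂ n
  have hcoeff := hasSum_latticeFourierCoeff b (P := fun u => ∑ i,
        pairing (frameOperator (hg' i) (hh' i) (tfShift (-u) f₁)) (tfShift (-u) f₂))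
    (continuous_finsetSum _ fun i _ => continuous_periodization (hg' i) (hh' i) f₁ f₂) ?_ ?_
  · rw [← (adjointLatticeEquiv b).toEquiv.hasSum_iff]
    simp only [neg_zero, tfShift_zero] at hcoeff
    exact hcoeff.congr_fun fun n => (hc n).symm
  · intro u z hz
    refine Finset.sum_congr rfl fun i _ => ?_
    rw [← (hasSum_periodization (hg' i) (hh' i) f₁ f₂ (u + z)).tsum_eq,
      ← (hasSum_periodization (hg' i) (hh' i) f₁ f₂ u).tsum_eq,
      ← (Equiv.addLeft (⟨z, hz⟩ : Submodule.span ℤ (Set.range b))).tsum_eq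
        fun v => stft (g i) f₁ (u + v) * conj (stft (h i) f₂ (u + v))]
    exact tsum_congr fun v => by simp [add_assoc]
  · exact ((adjointLatticeEquiv b).toEquiv.summable_iff.mpr hsum).congr fun n => (hc n).symm

end Basis

/-! ### The Janssen representation and the Wexler–Raz relations -/

section Janssen

variable {ι : Type*} [Fintype ι] (b : Module.Basis ι ℝ (PhaseSpace d))
variable {M : ℕ} {g h : Fin M → L2 d}

theorem summable_janssen (hg : ∀ i, g i ∈ feichtingerAlgebra d)
    (hh : ∀ i, h i ∈ feichtingerAlgebra d) (c : ℂ) (f : L2 d) :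
    Summable fun p : Fin M × adjointLattice (Submodule.span ℤ (Set.range b)) =>
      (c * pairing (h p.1) (tfShift (p.2 : PhaseSpace d) (g p.1))) •
        tfShift (p.2 : PhaseSpace d) f := by
  refine .of_norm ((summable_prod_of_nonneg fun _ => norm_nonneg _).mpr
    ⟨fun i => ?_, Summable.of_finite⟩)
  simp only [norm_smul, norm_mul, norm_tfShift]
  exact ((summable_norm_stft_adjointLattice b (hg i) (hh i)).mul_left _).mul_right _

/-- The series is already norm-summable, so its limit need only be identified weakly, by the
fundamental identity with f₂ = k. -/
theorem hasSum_janssen (hg : ∀ i, g i ∈ feichtingerAlgebra d)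
    (hh : ∀ i, h i ∈ feichtingerAlgebra d)
    (hg' : ∀ i, Summable fun z : Submodule.span ℤ (Set.range b) => ‖stft (g i) (g i) z‖)
    (hh' : ∀ i, Summable fun z : Submodule.span ℤ (Set.range b) => ‖stft (h i) (h i) z‖)
    (f : L2 d) :
    HasSum (fun p : Fin M × adjointLattice (Submodule.span ℤ (Set.range b)) =>
      (((volume.real (ZSpan.fundamentalDomain b) : ℝ) : ℂ)⁻¹ *
        pairing (h p.1) (tfShift (p.2 : PhaseSpace d) (g p.1))) •
          tfShift (p.2 : PhaseSpace d) f)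
      (∑ i, frameOperator (hg' i) (hh' i) f) := by
  have hs := (summable_janssen b hg hh
    ((volume.real (ZSpan.fundamentalDomain b) : ℝ) : ℂ)⁻¹ f).hasSum
  convert hs using 1
  refine ext_inner_left ℂ fun k => ?_
  -- Swapping the factors makes each fibre a finite sum over i, the form in which the fundamental
  -- identity is available.
  have h1 := (((Equiv.prodComm _ _).hasSum_iff.mpr hs).prod_fiberwise
    fun w => hasSum_fintype _).pairing_left k
  have h2 := hasSum_pairing_adjointLattice b hg hh hg' hh' f k
  rw [inner_sum]
  refine h2.unique (h1.congr_fun fun w => ?_)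
  rw [Finset.mul_sum, pairing_sum_left]
  refine Finset.sum_congr rfl fun i _ => ?_
  rw [← mul_assoc]
  exact (pairing_smul_left _ _ _).symm

theorem hasSum_janssen_collapsed (hg : ∀ i, g i ∈ feichtingerAlgebra d)
    (hh : ∀ i, h i ∈ feichtingerAlgebra d)
    (hg' : ∀ i, Summable fun z : Submodule.span ℤ (Set.range b) => ‖stft (g i) (g i) z‖)
    (hh' : ∀ i, Summable fun z : Submodule.span ℤ (Set.range b) => ‖stft (h i) (h i) z‖)
    (f : L2 d) :
    HasSum (fun w : adjointLattice (Submodule.span ℤ (Set.range b)) =>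
      (((volume.real (ZSpan.fundamentalDomain b) : ℝ) : ℂ)⁻¹ *
        ∑ i, pairing (h i) (tfShift (w : PhaseSpace d) (g i))) • tfShift (w : PhaseSpace d) f)
      (∑ i, frameOperator (hg' i) (hh' i) f) := by
  have h1 := ((Equiv.prodComm _ _).hasSum_iff.mpr
    (hasSum_janssen b hg hh hg' hh' f)).prod_fiberwise fun w => hasSum_fintype _
  refine h1.congr_fun fun w => ?_
  rw [Finset.mul_sum, Finset.sum_smul]
  rfl

/-- If S = I, the periodization attached to any f₁, f₂ is constant, so its coefficients off 0
vanish. Choosing f₁ Gaussian and f₂ = π(w)f₁ makes the factor ⟨π(w)f₁, f₂⟩ = ‖f₁‖² cancellable.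
Conversely, only the term w = 0 of the Janssen series survives. -/
theorem wexlerRaz (hg : ∀ i, g i ∈ feichtingerAlgebra d) (hh : ∀ i, h i ∈ feichtingerAlgebra d)
    (hg' : ∀ i, Summable fun z : Submodule.span ℤ (Set.range b) => ‖stft (g i) (g i) z‖)
    (hh' : ∀ i, Summable fun z : Submodule.span ℤ (Set.range b) => ‖stft (h i) (h i) z‖) :
    (∀ f, ∑ i, frameOperator (hg' i) (hh' i) f = f) ↔
      ∀ w ∈ adjointLattice (Submodule.span ℤ (Set.range b)),
        ((volume.real (ZSpan.fundamentalDomain b) : ℝ) : ℂ)⁻¹ *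
          ∑ i, pairing (h i) (tfShift w (g i)) = if w = 0 then 1 else 0 := by
  constructor
  · intro hS w hw
    obtain ⟨n, hn⟩ := (adjointLatticeEquiv b).surjective ⟨w, hw⟩
    have hw0 : n = 0 ↔ w = 0 := by
      rw [← (adjointLatticeEquiv b).map_eq_zero_iff, hn, Submodule.mk_eq_zero]
    have hconst : (fun u : PhaseSpace d => ∑ i, pairing (frameOperator (hg' i) (hh' i)
        (tfShift (-u) (gaussianWindow d))) (tfShift (-u) (tfShift w (gaussianWindow d)))) =
        fun _ => pairing (gaussianWindow d) (tfShift w (gaussianWindow d)) := by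
      ext u
      rw [← pairing_tfShift_tfShift (-u)]
      conv_rhs => rw [← hS (tfShift (-u) (gaussianWindow d)), pairing, inner_sum]
      rfl
    have hcoeff := latticeFourierCoeff_frameOperator b hg' hh' (gaussianWindow d)
      (tfShift w (gaussianWindow d)) n
    rw [hconst, latticeFourierCoeff_const, hn, ← Finset.sum_mul, ← mul_assoc,
      pairing_tfShift_tfShift] at hcoeff
    have hne : pairing (gaussianWindow d) (gaussianWindow d) ≠ 0 := by
      rw [pairing_self]
      simpa using gaussianWindow_ne_zero
    refine mul_right_cancel₀ hne (hcoeff.symm.trans ?_)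
    by_cases h0 : w = 0
    · rw [if_pos (hw0.mpr h0), if_pos h0, h0, tfShift_zero, one_mul]
    · rw [if_neg (mt hw0.mp h0), if_neg h0, zero_mul]
  · intro hw f
    refine (hasSum_janssen_collapsed b hg hh hg' hh' f).unique ?_
    have h0 := hasSum_single (f := fun w : adjointLattice (Submodule.span ℤ (Set.range b)) =>
      (((volume.real (ZSpan.fundamentalDomain b) : ℝ) : ℂ)⁻¹ *
        ∑ i, pairing (h i) (tfShift (w : PhaseSpace d) (g i))) • tfShift (w : PhaseSpace d) f) 0
      fun w hw0 => by rw [hw w w.2, if_neg (by simpa using hw0), zero_smul]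
    rw [hw _ (Submodule.coe_mem _)] at h0
    simpa [tfShift_zero] using h0

end Janssen

/-! ### Passage to an arbitrary lattice, and the theorem -/

theorem exists_basis_span_eq (Λ : Submodule ℤ (PhaseSpace d)) [DiscreteTopology Λ]
    [IsZLattice ℝ Λ] : ∃ (ι : Type) (_ : Fintype ι) (b : Module.Basis ι ℝ (PhaseSpace d)),
      Submodule.span ℤ (Set.range b) = Λ :=
  have := ZLattice.module_free ℝ Λ
  have := ZLattice.module_finite ℝ Λ
  ⟨_, inferInstance, (Module.Free.chooseBasis ℤ Λ).ofZLatticeBasis ℝ Λ,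
    (Module.Free.chooseBasis ℤ Λ).ofZLatticeBasis_span ℝ⟩

end

theorem mainTheorem9 (d M : ℕ) (Λ : Submodule ℤ (PhaseSpace d)) [DiscreteTopology Λ]
    [IsZLattice ℝ Λ] (g h : Fin M → L2 d)
    (hg : ∀ i, g i ∈ feichtingerAlgebra d) (hh : ∀ i, h i ∈ feichtingerAlgebra d) :
    -- the Fundamental Identity of Gabor Analysis, both sides converging absolutely
    (∀ f₁ f₂ : L2 d,
      (∀ i, Summable fun z : Λ =>
        pairing f₁ (tfShift (z : PhaseSpace d) (g i)) *
          pairing (tfShift (z : PhaseSpace d) (h i)) f₂) ∧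
      (∀ i, Summable fun w : adjointLattice Λ =>
        pairing (h i) (tfShift (w : PhaseSpace d) (g i)) *
          pairing (tfShift (w : PhaseSpace d) f₁) f₂) ∧
      ∑ i, ∑' z : Λ,
          pairing f₁ (tfShift (z : PhaseSpace d) (g i)) *
            pairing (tfShift (z : PhaseSpace d) (h i)) f₂ =
        ((ZLattice.covolume Λ)⁻¹ : ℂ) * ∑ i, ∑' w : adjointLattice Λ,
          pairing (h i) (tfShift (w : PhaseSpace d) (g i)) *
            pairing (tfShift (w : PhaseSpace d) f₁) f₂) ∧
    -- the Janssen representation: both series converge unconditionally in the strong sense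
    (∀ f : L2 d,
      (∀ i, Summable fun z : Λ =>
        pairing f (tfShift (z : PhaseSpace d) (g i)) • tfShift (z : PhaseSpace d) (h i)) ∧
      HasSum (fun p : Fin M × adjointLattice Λ =>
          (((ZLattice.covolume Λ)⁻¹ : ℂ) *
            pairing (h p.1) (tfShift (p.2 : PhaseSpace d) (g p.1))) •
              tfShift (p.2 : PhaseSpace d) f)
        (mixedFrameOperator Λ g h f)) ∧
    -- the Wexler-Raz biorthogonality relations
    ((∀ f : L2 d, mixedFrameOperator Λ g h f = f) ↔
      ∀ w ∈ adjointLattice Λ,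
        ((ZLattice.covolume Λ)⁻¹ : ℂ) * ∑ i, pairing (h i) (tfShift w (g i)) =
          if w = 0 then 1 else 0) := by

  obtain ⟨ι, _, b, rfl⟩ := exists_basis_span_eq Λ
  have hg' := fun i => summable_norm_stft b (hg i) (hg i)
  have hh' := fun i => summable_norm_stft b (hh i) (hh i)
  have hvol : ZLattice.covolume (Submodule.span ℤ (Set.range b)) =
      volume.real (ZSpan.fundamentalDomain b) :=
    ZLattice.covolume_eq_measure_fundamentalDomain _ _ (ZSpan.isAddFundamentalDomain b volume)
  -- Definitional: `stft` unfolds to `pairing`, and `frameOperator` is built on the same `tsum`.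
  have hS : ∀ f, mixedFrameOperator (Submodule.span ℤ (Set.range b)) g h f =
      ∑ i, frameOperator (hg' i) (hh' i) f := fun f => rfl
  simp only [hvol, hS]
  refine ⟨fun f₁ f₂ => ⟨fun i => ?_, fun i => ?_, ?_⟩, fun f => ⟨fun i => ?_, ?_⟩, ?_⟩
  · exact (hasSum_pairing_frameOperator (hg' i) (hh' i) f₁ f₂).summable
  · exact summable_pairing_mul b (hg i) (hh i) f₁ f₂
  · have h1 := (hasSum_pairing_adjointLattice b hg hh hg' hh' f₁ f₂).tsum_eq
    rw [tsum_mul_left,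
      Summable.tsum_finsetSum fun i _ => summable_pairing_mul b (hg i) (hh i) f₁ f₂] at h1
    rw [h1]
    exact Finset.sum_congr rfl fun i _ =>
      (hasSum_pairing_frameOperator (hg' i) (hh' i) f₁ f₂).tsum_eq
  · exact (hasSum_frameOperator (hg' i) (hh' i) f).summable
  · exact hasSum_janssen b hg hh hg' hh' f
  · exact wexlerRaz b hg hh hg' hh'
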